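/- Let $\Omega=(a,b)$ be a bounded open interval with $a<b$, $|\Omega|=b-a$, and let $s\in(0,1)$. Let $\lambda_k=(k\pi/|\Omega|)^2$, $k\ge 0$, be the eigenvalues and $\varphi_k$ the $L^2(\Omega)$-normalized eigenfunctions of $-\partial_{xx}$ on $\Omega$ with Neumann boundary conditions, that is $\varphi_0=|\Omega|^{-1/2}$ and $\varphi_k(x)=\sqrt{2/|\Omega|}\,\cos(k\pi(x-a)/|\Omega|)$ for $k\ge1$. For $v\in L^2(\Omega)$ put $c_k=\int_\Omega v\varphi_k\,dx$; write $v\in H^{r}_N(\Omega)$ if $\sum_k c_k^2(1+\lambda_k^r)<\infty$, and, for $\sigma>0$ and $v\in H^{2\sigma}_N(\Omega)$, put $(-\Delta)^{\sigma}v=\sum_k\lambda_k^{\sigma}c_k\varphi_k\in L^2(\Omega)$. Let $v\in H^{2s+1}_N(\Omega)$ with $v\ge0$ a.e. in $\Omega$. Then $(-\Delta)^s v$ has a weak derivative $\partial_x(-\Delta)^s v\in L^2(\Omega)$, and for every measurable $w:\Omega\to[0,\infty)$ $$\int_\Omega \frac{v^2}{w}\,dx\;\int_\Omega w\,\bigl|\partial_x(-\Delta)^s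 v\bigr|^2\,dx\;\ge\;\frac{1}{4|\Omega|^2}\left(\int_\Omega \bigl|(-\Delta)^{s/2}v\bigr|^2\,dx\right)^2 .$$ Here the integrals on the left are taken in $[0,\infty]$, with $v^2/w=+\infty$ where $w=0<v$ and $v^2/w=0$ where $w=v=0$; the inequality is claimed whenever the product on the left is not of the indeterminate form $\infty\cdot0$. -/

import Mathlib

open MeasureTheory Set
open scoped ENNReal NNReal ContDiff

/-- The `k`-th eigenvalue `(kπ/|Ω|)²` of the Neumann Laplacian `-∂ₓₓ` on `Ω = (a, b)`. -/
noncomputable def neumannEigenvalue (a b : ℝ) (k : ℕ) : ℝ :=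
  (k * Real.pi / (b - a)) ^ 2

/-- The `k`-th `L²`-normalized eigenfunction of the Neumann Laplacian on `Ω = (a, b)`: the constant
`1/√|Ω|` for `k = 0`, and `√(2/|Ω|) cos(kπ(x - a)/|Ω|)` for `k ≥ 1`. -/
noncomputable def neumannEigenfunction (a b : ℝ) (k : ℕ) (x : ℝ) : ℝ :=
  (if k = 0 then 1 / Real.sqrt (b - a) else Real.sqrt (2 / (b - a))) *
    Real.cos (k * Real.pi * (x - a) / (b - a))

theorem memLp_neumannEigenfunction (a b : ℝ) (k : ℕ) :
    MemLp (neumannEigenfunction a b k) 2 (volume.restrict (Ioo a b)) := by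
  have hc : Continuous (neumannEigenfunction a b k) := by
    unfold neumannEigenfunction
    fun_prop
  refine MemLp.of_bound hc.aestronglyMeasurable
    |if k = 0 then 1 / Real.sqrt (b - a) else Real.sqrt (2 / (b - a))|
    (Filter.Eventually.of_forall fun x => ?_)
  rw [neumannEigenfunction, Real.norm_eq_abs, abs_mul]
  exact mul_le_of_le_one_right (abs_nonneg _) (Real.abs_cos_le_one _)

/-- The coefficient `c_k = ⟨v, φ_k⟩` of `v` in the expansion `v = ∑ c_k φ_k` in `L²(a, b)`. -/
noncomputable def neumannCoeff (a b : ℝ) (v : ℝ → ℝ) (k : ℕ) : ℝ :=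
  ∫ x in Ioo a b, v x * neumannEigenfunction a b k x

/-- `v ∈ H^r_N(a, b)`: `v ∈ L²(a, b)` and `∑ c_k² (1 + λ_k^r) < ∞`.
(The eigenfunctions form a Hilbert basis of `L²(a, b)`, so `v = ∑ c_k φ_k`.) -/
def MemHN (a b r : ℝ) (v : ℝ → ℝ) : Prop :=
  MemLp v 2 (volume.restrict (Ioo a b)) ∧
    Summable fun k : ℕ => neumannCoeff a b v k ^ 2 * (1 + neumannEigenvalue a b k ^ r)

/-- The spectral Neumann fractional Laplacian `(-Δ)^s v = ∑ λ_k^s c_k φ_k`, the series being taken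
in `L²(a, b)`. It converges there exactly when `∑ λ_k^{2s} c_k² < ∞`, in particular for
`v ∈ H^{2s}_N(a, b)`. -/
noncomputable def neumannFracLaplacian (a b s : ℝ) (v : ℝ → ℝ) :
    Lp ℝ 2 (volume.restrict (Ioo a b)) :=
  ∑' k : ℕ, (neumannEigenvalue a b k ^ s * neumannCoeff a b v k) •
    (memLp_neumannEigenfunction a b k).toLp (neumannEigenfunction a b k)

/-- `h` is the weak (distributional) derivative of `g` on the open interval `(a, b)`. -/
def HasWeakDerivOn (a b : ℝ) (g h : ℝ → ℝ) : Prop :=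
  LocallyIntegrableOn g (Ioo a b) ∧ LocallyIntegrableOn h (Ioo a b) ∧
    ∀ φ : ℝ → ℝ, ContDiff ℝ ∞ φ → HasCompactSupport φ → tsupport φ ⊆ Ioo a b →
      ∫ x in Ioo a b, g x * deriv φ x = - ∫ x in Ioo a b, h x * φ x

/-!
Write `v = u + m` with `m = min v ≥ 0`, so that `u ≥ 0` vanishes at some `x₀ ∈ [a, b]`, and let `ψ`
be the sawtooth weight with `ψ' = 1` off `x₀` and `|ψ| ≤ |Ω|`. For the Neumann resolvent
`z = R_t u`, `R_t = (1 - t⁻¹ ∂ₓₓ)⁻¹`, integrating by parts gives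
`∫ ψ u z' + ½ ∫ u z = (|Ω|/2) (z(x₀)² - z'(x₀)²/t) + ∫ (u z - z²)`. Here `u z - z²` has the integral
`t⁻¹ ∫ z'²`, and `|z'| ≤ √t z` because `u ≥ 0`, so the right-hand side is nonnegative. It is at most
`(|Ω|/2) z(x₀)² + ∫ (u z - z²)`, which tends to `0` as `t → ∞`, whence `∫ ψ u u' + ½ ∫ u² = 0`.
Subtracting the two relations gives `-∫ ψ u ∂ₓ(1 - R_t) u ≥ ½ ∫ u (1 - R_t) u`, and since `(-Δ)^s`
is a positive superposition of the operators `1 - R_t` for `0 < s < 1`, also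
`-∫ ψ u ∂ₓ(-Δ)^s u ≥ ½ ∫ |(-Δ)^{s/2} u|²`. Finally `|ψ| ≤ |Ω|`, `u ≤ v`, and the weighted
Cauchy–Schwarz inequality yield the claim.
-/

theorem integral_Ioo_eq_intervalIntegral {a b : ℝ} (hab : a ≤ b) (f : ℝ → ℝ) :
    ∫ x in Ioo a b, f x = ∫ x in a..b, f x := by
  rw [intervalIntegral.integral_of_le hab, integral_Ioc_eq_integral_Ioo]

/-! ### Neumann and Dirichlet eigenfunctions -/

/-- The square root `kπ/|Ω|` of the `k`-th eigenvalue, the frequency of the `k`-th Neumann and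
Dirichlet eigenfunctions. -/
noncomputable def neumannFreq (a b : ℝ) (k : ℕ) : ℝ := k * Real.pi / (b - a)

/-- The `k`-th `L²`-normalized Dirichlet eigenfunction `√(2/|Ω|) sin(kπ(x - a)/|Ω|)`. It is also
defined for `k = 0`, where it vanishes, so that derivatives of Neumann series need no shift of the
index. -/
noncomputable def dirichletEigenfunction (a b : ℝ) (k : ℕ) (x : ℝ) : ℝ :=
  Real.sqrt (2 / (b - a)) * Real.sin (k * Real.pi * (x - a) / (b - a))

section Eigenfunctions

variable {a b : ℝ}

theorem neumannEigenvalue_eq_sq (a b : ℝ) (k : ℕ) :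
    neumannEigenvalue a b k = neumannFreq a b k ^ 2 := rfl

theorem neumannEigenvalue_nonneg (a b : ℝ) (k : ℕ) : 0 ≤ neumannEigenvalue a b k :=
  sq_nonneg _

theorem neumannEigenvalue_zero (a b : ℝ) : neumannEigenvalue a b 0 = 0 := by
  simp [neumannEigenvalue]

theorem neumannFreq_zero (a b : ℝ) : neumannFreq a b 0 = 0 := by
  simp [neumannFreq]

theorem neumannFreq_nonneg (hab : a ≤ b) (k : ℕ) : 0 ≤ neumannFreq a b k :=
  div_nonneg (by positivity) (sub_nonneg.2 hab)

theorem neumannFreq_injective (hab : a ≠ b) : Function.Injective (neumannFreq a b) := by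
  intro j k h
  have hL : b - a ≠ 0 := sub_ne_zero.2 hab.symm
  simpa [neumannFreq, hL, Real.pi_ne_zero] using h

theorem neumannFreq_ne_zero (hab : a ≠ b) {k : ℕ} (hk : k ≠ 0) : neumannFreq a b k ≠ 0 := by
  simp [neumannFreq, hk, Real.pi_ne_zero, sub_ne_zero.2 hab.symm]

theorem dirichletEigenfunction_left (a b : ℝ) (k : ℕ) : dirichletEigenfunction a b k a = 0 := by
  simp [dirichletEigenfunction]

theorem dirichletEigenfunction_right (a b : ℝ) (k : ℕ) : dirichletEigenfunction a b k b = 0 := by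
  rcases eq_or_ne (b - a) 0 with hL | hL <;>
    simp [dirichletEigenfunction, hL, Real.sin_nat_mul_pi]

theorem continuous_neumannEigenfunction (a b : ℝ) (k : ℕ) :
    Continuous (neumannEigenfunction a b k) := by
  unfold neumannEigenfunction
  fun_prop

theorem continuous_dirichletEigenfunction (a b : ℝ) (k : ℕ) :
    Continuous (dirichletEigenfunction a b k) := by
  unfold dirichletEigenfunction
  fun_prop

theorem abs_neumannEigenfunction_le (a b : ℝ) (k : ℕ) (x : ℝ) :
    |neumannEigenfunction a b k x| ≤ Real.sqrt (2 / (b - a)) := by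
  have hcoeff : |if k = 0 then 1 / Real.sqrt (b - a) else Real.sqrt (2 / (b - a))| ≤
      Real.sqrt (2 / (b - a)) := by
    split_ifs
    · rw [abs_of_nonneg (by positivity), Real.sqrt_div zero_le_two]
      gcongr
      exact Real.one_le_sqrt.2 one_le_two
    · rw [abs_of_nonneg (Real.sqrt_nonneg _)]
  rw [neumannEigenfunction, abs_mul]
  exact (mul_le_of_le_one_right (abs_nonneg _) (Real.abs_cos_le_one _)).trans hcoeff

theorem abs_dirichletEigenfunction_le (a b : ℝ) (k : ℕ) (x : ℝ) :
    |dirichletEigenfunction a b k x| ≤ Real.sqrt (2 / (b - a)) := by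
  rw [dirichletEigenfunction, abs_mul, abs_of_nonneg (Real.sqrt_nonneg _)]
  exact mul_le_of_le_one_right (Real.sqrt_nonneg _) (Real.abs_sin_le_one _)

theorem hasDerivAt_phase (a b : ℝ) (k : ℕ) (x : ℝ) :
    HasDerivAt (fun y => k * Real.pi * (y - a) / (b - a)) (neumannFreq a b k) x := by
  simpa [neumannFreq] using
    (((hasDerivAt_id x).sub_const a).const_mul (k * Real.pi)).div_const (b - a)

theorem hasDerivAt_neumannEigenfunction (a b : ℝ) (k : ℕ) (x : ℝ) :
    HasDerivAt (neumannEigenfunction a b k)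
      (-(neumannFreq a b k * dirichletEigenfunction a b k x)) x := by
  refine ((hasDerivAt_phase a b k x).cos.const_mul _).congr_deriv ?_
  rcases eq_or_ne k 0 with rfl | hk
  · simp [neumannFreq]
  · simp only [hk, if_false, dirichletEigenfunction]
    ring

theorem hasDerivAt_dirichletEigenfunction (a b : ℝ) (k : ℕ) (x : ℝ) :
    HasDerivAt (dirichletEigenfunction a b k)
      (neumannFreq a b k * neumannEigenfunction a b k x) x := by
  refine ((hasDerivAt_phase a b k x).sin.const_mul _).congr_deriv ?_
  rcases eq_or_ne k 0 with rfl | hk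
  · simp [neumannFreq]
  · simp only [hk, if_false, neumannEigenfunction]
    ring

theorem neumannFreq_mul_integral (a b : ℝ) (j k : ℕ) :
    neumannFreq a b j * ∫ x in a..b, neumannEigenfunction a b j x * neumannEigenfunction a b k x =
      neumannFreq a b k *
        ∫ x in a..b, dirichletEigenfunction a b j x * dirichletEigenfunction a b k x := by
  have hc := continuous_neumannEigenfunction a b
  have hs := continuous_dirichletEigenfunction a b
  have parts := intervalIntegral.integral_deriv_mul_eq_sub
    (fun x _ => hasDerivAt_dirichletEigenfunction a b j x)
    (fun x _ => hasDerivAt_neumannEigenfunction a b k x)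
    (Continuous.intervalIntegrable (by fun_prop) a b)
    (Continuous.intervalIntegrable (by fun_prop) a b)
  rw [dirichletEigenfunction_left, dirichletEigenfunction_right, zero_mul, zero_mul, sub_zero,
    intervalIntegral.integral_add (Continuous.intervalIntegrable (by fun_prop) a b)
      (Continuous.intervalIntegrable (by fun_prop) a b)] at parts
  simp only [mul_assoc, mul_neg, mul_left_comm _ (neumannFreq a b k),
    intervalIntegral.integral_const_mul, intervalIntegral.integral_neg] at parts
  linarith

theorem neumannEigenfunction_sq_add_dirichletEigenfunction_sq (hab : a < b) {k : ℕ} (hk : k ≠ 0)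
    (x : ℝ) : neumannEigenfunction a b k x ^ 2 + dirichletEigenfunction a b k x ^ 2 =
      2 / (b - a) := by
  have : 0 < b - a := sub_pos.2 hab
  simp only [neumannEigenfunction, dirichletEigenfunction, hk, if_false, mul_pow, ← mul_add,
    Real.cos_sq_add_sin_sq, mul_one]
  exact Real.sq_sqrt (by positivity)

theorem integral_neumannEigenfunction_mul_self (hab : a < b) (k : ℕ) :
    ∫ x in a..b, neumannEigenfunction a b k x * neumannEigenfunction a b k x = 1 := by
  have hL := sub_pos.2 hab
  rcases eq_or_ne k 0 with rfl | hk
  · simp [neumannEigenfunction, ← mul_inv, Real.mul_self_sqrt hL.le, hL.ne']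
  have hμ := neumannFreq_ne_zero hab.ne hk
  have heq := mul_left_cancel₀ hμ (neumannFreq_mul_integral a b k k)
  have hc := continuous_neumannEigenfunction a b k
  have hs := continuous_dirichletEigenfunction a b k
  have hsum : (∫ x in a..b, neumannEigenfunction a b k x * neumannEigenfunction a b k x) +
      ∫ x in a..b, dirichletEigenfunction a b k x * dirichletEigenfunction a b k x = 2 := by
    rw [← intervalIntegral.integral_add (Continuous.intervalIntegrable (by fun_prop) a b)
      (Continuous.intervalIntegrable (by fun_prop) a b)]
    simp only [← sq, neumannEigenfunction_sq_add_dirichletEigenfunction_sq hab hk,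
      intervalIntegral.integral_const, smul_eq_mul]
    field_simp
  linarith

theorem integral_neumannEigenfunction_mul (hab : a < b) (j k : ℕ) :
    ∫ x in a..b, neumannEigenfunction a b j x * neumannEigenfunction a b k x =
      if j = k then 1 else 0 := by
  split_ifs with hjk
  · rw [hjk, integral_neumannEigenfunction_mul_self hab]
  have h₁ := neumannFreq_mul_integral a b j k
  have h₂ := neumannFreq_mul_integral a b k j
  simp only [mul_comm (neumannEigenfunction a b k _), mul_comm (dirichletEigenfunction a b k _)]
    at h₂
  have hsq : neumannFreq a b j ^ 2 - neumannFreq a b k ^ 2 ≠ 0 := by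
    rw [sub_ne_zero, Ne, sq_eq_sq₀ (neumannFreq_nonneg hab.le j) (neumannFreq_nonneg hab.le k)]
    exact fun h => hjk (neumannFreq_injective hab.ne h)
  refine (mul_eq_zero.1 ?_).resolve_left hsq
  linear_combination neumannFreq a b j * h₁ - neumannFreq a b k * h₂

theorem integral_dirichletEigenfunction_mul (hab : a < b) (j : ℕ) {k : ℕ} (hk : k ≠ 0) :
    ∫ x in a..b, dirichletEigenfunction a b j x * dirichletEigenfunction a b k x =
      if j = k then 1 else 0 := by
  have hμ := neumannFreq_ne_zero hab.ne hk
  refine mul_left_cancel₀ hμ ?_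
  rw [← neumannFreq_mul_integral, integral_neumannEigenfunction_mul hab]
  split_ifs with hjk
  · rw [hjk]
  · simp

end Eigenfunctions

/-! ### Completeness of the Neumann eigenfunctions -/

theorem ae_eq_zero_of_setIntegral_contDiff_smul_eq_zero {E F : Type*} [NormedAddCommGroup E]
    [NormedSpace ℝ E] [FiniteDimensional ℝ E] [MeasurableSpace E] [BorelSpace E]
    [NormedAddCommGroup F] [NormedSpace ℝ F] [CompleteSpace F] {μ : Measure E} {U : Set E}
    (hU : IsOpen U) {f : E → F} (hf : LocallyIntegrableOn f U μ)
    (h : ∀ g : E → ℝ, ContDiff ℝ ∞ g → HasCompactSupport g → tsupport g ⊆ U →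
      ∫ x in U, g x • f x ∂μ = 0) :
    f =ᵐ[μ.restrict U] 0 := by
  refine (ae_restrict_iff' hU.measurableSet).2
    (hU.ae_eq_zero_of_integral_contDiff_smul_eq_zero hf fun g hg hgc hgU => ?_)
  rw [← setIntegral_eq_integral_of_forall_compl_eq_zero fun x hx => ?_]
  · exact h g hg hgc hgU
  · rw [image_eq_zero_of_notMem_tsupport fun hxg => hx (hgU hxg), zero_smul]

section CosineMoments

variable {α : Type*} [MeasurableSpace α] {μ : Measure α} {f θ : α → ℝ}

theorem integrable_mul_comp_cos {G : ℝ → ℝ} (hf : Integrable f μ) (hθ : AEMeasurable θ μ)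
    (hG : Continuous G) : Integrable (fun x => f x * G (Real.cos (θ x))) μ := by
  obtain ⟨C, hC⟩ := isCompact_Icc.exists_bound_of_continuousOn hG.continuousOn
  refine hf.mul_bdd (c := C)
    (hG.measurable.comp_aemeasurable hθ.cos).aestronglyMeasurable ?_
  exact .of_forall fun x => hC _ (Real.cos_mem_Icc _)

theorem integral_mul_eval_cos_eq_zero (hf : Integrable f μ) (hθ : AEMeasurable θ μ)
    (h : ∀ k : ℕ, ∫ x, f x * Real.cos (k * θ x) ∂μ = 0) (p : Polynomial ℝ) :
    ∫ x, f x * p.eval (Real.cos (θ x)) ∂μ = 0 := by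
  have hint (q : Polynomial ℝ) := integrable_mul_comp_cos hf hθ q.continuous
  -- The Chebyshev polynomials `Tₖ (cos θ) = cos (k θ)` span all polynomials.
  have hp : p ∈ Submodule.span ℝ (range (Polynomial.Chebyshev.chebyshevTsequence ℝ)) := by
    rw [Polynomial.Sequence.span _ fun k => ?_]
    · exact Submodule.mem_top
    · exact (Polynomial.leadingCoeff_ne_zero.2
        (Polynomial.Sequence.ne_zero _ k)).isUnit
  induction hp using Submodule.span_induction with
  | mem q hq =>
    obtain ⟨k, rfl⟩ := hq
    simpa [Polynomial.Chebyshev.chebyshevTsequence] using h k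
  | zero => simp
  | add q₁ q₂ _ _ h₁ h₂ =>
    simp only [Polynomial.eval_add, mul_add]
    rw [integral_add (hint q₁) (hint q₂), h₁, h₂, add_zero]
  | smul c q _ hq =>
    simp only [Polynomial.eval_smul, smul_eq_mul, mul_left_comm _ c]
    rw [integral_const_mul, hq, mul_zero]

theorem integral_mul_comp_cos_eq_zero {G : ℝ → ℝ} (hf : Integrable f μ) (hθ : AEMeasurable θ μ)
    (h : ∀ k : ℕ, ∫ x, f x * Real.cos (k * θ x) ∂μ = 0) (hG : Continuous G) :
    ∫ x, f x * G (Real.cos (θ x)) ∂μ = 0 := by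
  set I := ∫ x, ‖f x‖ ∂μ
  have hI : 0 ≤ I := integral_nonneg fun x => norm_nonneg (f x)
  refine norm_le_zero_iff.1 (le_of_forall_pos_le_add fun ε hε => ?_)
  obtain ⟨p, hp⟩ := exists_polynomial_near_of_continuousOn (-1) 1 G hG.continuousOn
    (ε / (I + 1)) (by positivity)
  have hsub : ∫ x, f x * G (Real.cos (θ x)) ∂μ =
      ∫ x, f x * (G (Real.cos (θ x)) - p.eval (Real.cos (θ x))) ∂μ := by
    simp_rw [mul_sub]
    rw [integral_sub (integrable_mul_comp_cos hf hθ hG)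
      (integrable_mul_comp_cos hf hθ p.continuous), integral_mul_eval_cos_eq_zero hf hθ h, sub_zero]
  calc ‖∫ x, f x * G (Real.cos (θ x)) ∂μ‖
      ≤ ∫ x, ‖f x‖ * (ε / (I + 1)) ∂μ := by
        rw [hsub]
        refine norm_integral_le_of_norm_le (hf.norm.mul_const _) (.of_forall fun x => ?_)
        rw [norm_mul, Real.norm_eq_abs (_ - _), abs_sub_comm]
        gcongr
        exact (hp _ (Real.cos_mem_Icc _)).le
    _ = I / (I + 1) * ε := by rw [integral_mul_const]; ring
    _ ≤ 0 + ε := by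
        rw [zero_add]
        exact mul_le_of_le_one_left hε.le (div_le_one_of_le₀ (by linarith) (by linarith))

end CosineMoments

section Completeness

variable {a b : ℝ} {f : ℝ → ℝ}

theorem integral_mul_cos_eq_zero_of_neumannCoeff_eq_zero (hab : a < b) {k : ℕ}
    (hk : neumannCoeff a b f k = 0) :
    ∫ x in Ioo a b, f x * Real.cos (k * (Real.pi * (x - a) / (b - a))) = 0 := by
  have : 0 < b - a := sub_pos.2 hab
  set A : ℝ := if k = 0 then 1 / Real.sqrt (b - a) else Real.sqrt (2 / (b - a)) with hA
  have hA0 : A ≠ 0 := by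
    rw [hA]
    split_ifs <;> positivity
  refine (mul_eq_zero.1 ?_).resolve_left hA0
  rw [← integral_const_mul, ← hk, neumannCoeff]
  refine integral_congr_ae (.of_forall fun x => ?_)
  simp only [neumannEigenfunction, ← hA]
  ring_nf

theorem integral_mul_continuous_eq_zero_of_neumannCoeff_eq_zero (hab : a < b)
    (hf : IntegrableOn f (Ioo a b)) (h : ∀ k, neumannCoeff a b f k = 0) {g : ℝ → ℝ}
    (hg : Continuous g) : ∫ x in Ioo a b, f x * g x = 0 := by
  have hL := sub_pos.2 hab
  have hG : Continuous fun t => g (a + (b - a) / Real.pi * Real.arccos t) :=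
    hg.comp (continuous_const.add (continuous_const.mul Real.continuous_arccos))
  rw [← integral_mul_comp_cos_eq_zero hf (θ := fun x => Real.pi * (x - a) / (b - a)) (by fun_prop)
    (fun k => integral_mul_cos_eq_zero_of_neumannCoeff_eq_zero hab (h k)) hG]
  refine setIntegral_congr_fun measurableSet_Ioo fun x hx => ?_
  have hθ₀ : 0 ≤ Real.pi * (x - a) / (b - a) :=
    div_nonneg (mul_nonneg Real.pi_pos.le (sub_nonneg.2 hx.1.le)) hL.le
  have hθπ : Real.pi * (x - a) / (b - a) ≤ Real.pi :=
    (div_le_iff₀ hL).2 (mul_le_mul_of_nonneg_left (by linarith [hx.2]) Real.pi_pos.le)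
  have hθ : a + (b - a) / Real.pi * (Real.pi * (x - a) / (b - a)) = x := by
    field_simp
    ring
  simp only [Real.arccos_cos hθ₀ hθπ, hθ]

theorem ae_eq_zero_of_neumannCoeff_eq_zero (hab : a < b) (hf : IntegrableOn f (Ioo a b))
    (h : ∀ k, neumannCoeff a b f k = 0) : f =ᵐ[volume.restrict (Ioo a b)] 0 := by
  refine ae_eq_zero_of_setIntegral_contDiff_smul_eq_zero isOpen_Ioo hf.locallyIntegrableOn
    fun g hg _ _ => ?_
  simp only [smul_eq_mul, mul_comm (g _)]
  exact integral_mul_continuous_eq_zero_of_neumannCoeff_eq_zero hab hf h hg.continuous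

end Completeness

theorem HasWeakDerivOn.ae_eq {a b : ℝ} {g h₁ h₂ : ℝ → ℝ} (h1 : HasWeakDerivOn a b g h₁)
    (h2 : HasWeakDerivOn a b g h₂) : h₁ =ᵐ[volume.restrict (Ioo a b)] h₂ := by
  have hint {f : ℝ → ℝ} (hf : LocallyIntegrableOn f (Ioo a b)) {φ : ℝ → ℝ} (hφ : Continuous φ)
      (hφc : HasCompactSupport φ) (hφU : tsupport φ ⊆ Ioo a b) :
      IntegrableOn (fun x => φ x • f x) (Ioo a b) := by
    refine ((hf.integrableOn_compact_subset hφU hφc).continuousOn_smul hφ.continuousOn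
      hφc).of_forall_sdiff_eq_zero measurableSet_Ioo fun x hx => ?_
    rw [image_eq_zero_of_notMem_tsupport hx.2, zero_smul]
  suffices h₁ - h₂ =ᵐ[volume.restrict (Ioo a b)] 0 by
    filter_upwards [this] with x hx using sub_eq_zero.1 hx
  refine ae_eq_zero_of_setIntegral_contDiff_smul_eq_zero isOpen_Ioo (h1.2.1.sub h2.2.1)
    fun φ hφ hφc hφU => ?_
  have hparts := (h1.2.2 φ hφ hφc hφU).symm.trans (h2.2.2 φ hφ hφc hφU)
  simp only [Pi.sub_apply, smul_sub]
  rw [integral_sub (hint h1.2.1 hφ.continuous hφc hφU) (hint h2.2.1 hφ.continuous hφc hφU)]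
  simp only [smul_eq_mul, mul_comm (φ _)]
  linarith

/-! ### The virial identity for the Neumann resolvent -/

/-- The virial weight on `(a, b)` centred at `x₀`: it has slope `1`, vanishes at both endpoints of
the interval and jumps by `-|Ω|` at `x₀`. -/
noncomputable def sawtooth (a b x₀ x : ℝ) : ℝ := if x ≤ x₀ then x - a else x - b

section Sawtooth

variable {a b x₀ : ℝ}

theorem measurable_sawtooth (a b x₀ : ℝ) : Measurable (sawtooth a b x₀) :=
  Measurable.ite measurableSet_Iic (measurable_id.sub_const a) (measurable_id.sub_const b)

theorem abs_sawtooth_le {x : ℝ} (hx : x ∈ Icc a b) : |sawtooth a b x₀ x| ≤ b - a := by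
  unfold sawtooth
  split_ifs <;> rw [abs_le] <;> constructor <;> linarith [hx.1, hx.2]

theorem integral_sawtooth_mul_deriv (hx₀ : x₀ ∈ Icc a b) {F F' : ℝ → ℝ}
    (hF : ∀ x ∈ Icc a b, HasDerivAt F (F' x) x) (hF' : IntervalIntegrable F' volume a b) :
    ∫ x in a..b, sawtooth a b x₀ x * F' x = (b - a) * F x₀ - ∫ x in a..b, F x := by
  have hab : a ≤ b := hx₀.1.trans hx₀.2
  have hparts := intervalIntegral.integral_mul_deriv_eq_deriv_mul (u := fun x => x - b)
    (u' := fun _ => 1) (fun x _ => (hasDerivAt_id x).sub_const b)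
    (fun x hx => hF x (uIcc_of_le hab ▸ hx)) (by simp) hF'
  have hjump : ∫ x in a..b, {y | y ≤ x₀}.indicator F' x = F x₀ - F a := by
    rw [intervalIntegral.integral_indicator hx₀]
    refine intervalIntegral.integral_eq_sub_of_hasDerivAt (fun x hx => hF x ?_)
      (hF'.mono_set ?_)
    · exact Icc_subset_Icc_right hx₀.2 (uIcc_of_le hx₀.1 ▸ hx)
    · exact uIcc_subset_uIcc_left (uIcc_of_le hab ▸ hx₀)
  have hint : IntervalIntegrable ({y | y ≤ x₀}.indicator F') volume a b :=
    ⟨hF'.1.indicator measurableSet_Iic, hF'.2.indicator measurableSet_Iic⟩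
  calc ∫ x in a..b, sawtooth a b x₀ x * F' x
      = ∫ x in a..b, ((x - b) * F' x + (b - a) * {y | y ≤ x₀}.indicator F' x) := by
        refine intervalIntegral.integral_congr fun x _ => ?_
        by_cases hx : x ≤ x₀
        · simp [sawtooth, hx]
          ring
        · simp [sawtooth, hx]
    _ = (b - a) * F x₀ - ∫ x in a..b, F x := by
        rw [intervalIntegral.integral_add (hF'.continuousOn_mul (by fun_prop))
          (hint.const_mul _), intervalIntegral.integral_const_mul, hparts, hjump]
        simp only [one_mul]
        ring

end Sawtooth

theorem le_exp_mul_of_nonneg_deriv_add_mul {a b c : ℝ} {f f' : ℝ → ℝ}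
    (hf : ∀ x ∈ Icc a b, HasDerivAt f (f' x) x) (h : ∀ x ∈ Icc a b, 0 ≤ f' x + c * f x) {x y : ℝ}
    (hx : x ∈ Icc a b) (hy : y ∈ Icc a b) (hxy : x ≤ y) :
    f x ≤ Real.exp (c * (y - x)) * f y := by
  have hderiv (z : ℝ) (hz : z ∈ Icc a b) : HasDerivAt (fun z => Real.exp (c * z) * f z)
      (Real.exp (c * z) * (f' z + c * f z)) z := by
    refine (((hasDerivAt_id z).const_mul c).exp.mul (hf z hz)).congr_deriv ?_
    simp only [id, mul_one]
    ring
  have hmono : MonotoneOn (fun z => Real.exp (c * z) * f z) (Icc a b) :=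
    monotoneOn_of_hasDerivWithinAt_nonneg (convex_Icc a b)
      (fun z hz => (hderiv z hz).continuousAt.continuousWithinAt)
      (fun z hz => (hderiv z (interior_subset hz)).hasDerivWithinAt)
      fun z hz => mul_nonneg (Real.exp_pos _).le (h z (interior_subset hz))
  calc f x = Real.exp (-(c * x)) * (Real.exp (c * x) * f x) := by
        rw [← mul_assoc, ← Real.exp_add, neg_add_cancel, Real.exp_zero, one_mul]
    _ ≤ Real.exp (-(c * x)) * (Real.exp (c * y) * f y) :=
        mul_le_mul_of_nonneg_left (hmono hx hy hxy) (Real.exp_pos _).le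
    _ = Real.exp (c * (y - x)) * f y := by
        rw [← mul_assoc, ← Real.exp_add]
        ring_nf

/-- `w = (1 - t⁻¹ ∂ₓₓ)⁻¹ u` is the Neumann resolvent of `u` on `(a, b)` and `w'` its derivative.
The equation is written as `w'' = t (w - u)`. -/
structure NeumannResolvent (a b t : ℝ) (u w w' : ℝ → ℝ) : Prop where
  hasDerivAt : ∀ x, HasDerivAt w (w' x) x
  hasDerivAt_deriv : ∀ x, HasDerivAt w' (t * (w x - u x)) x
  deriv_left : w' a = 0
  deriv_right : w' b = 0

namespace NeumannResolvent

variable {a b t : ℝ} {u w w' : ℝ → ℝ}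

theorem continuous (h : NeumannResolvent a b t u w w') : Continuous w :=
  continuous_iff_continuousAt.2 fun x => (h.hasDerivAt x).continuousAt

theorem continuous_deriv (h : NeumannResolvent a b t u w w') : Continuous w' :=
  continuous_iff_continuousAt.2 fun x => (h.hasDerivAt_deriv x).continuousAt

theorem mul_sub_deriv_le_exp_mul {r : ℝ} (h : NeumannResolvent a b (r ^ 2) u w w')
    (hu : ∀ x ∈ Icc a b, 0 ≤ u x) {x y : ℝ} (hx : x ∈ Icc a b) (hy : y ∈ Icc a b) (hxy : x ≤ y) :
    r * w x - w' x ≤ Real.exp (r * (y - x)) * (r * w y - w' y) := by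
  refine le_exp_mul_of_nonneg_deriv_add_mul
    (fun z _ => ((h.hasDerivAt z).const_mul r).sub (h.hasDerivAt_deriv z)) (fun z hz => ?_)
    hx hy hxy
  refine (mul_nonneg (sq_nonneg r) (hu z hz)).trans_eq ?_
  simp only [Pi.sub_apply]
  ring

theorem of_neg {r : ℝ} (h : NeumannResolvent a b (r ^ 2) u w w') :
    NeumannResolvent a b ((-r) ^ 2) u w w' := by
  rwa [neg_sq]

theorem nonneg_endpoints {r : ℝ} (h : NeumannResolvent a b (r ^ 2) u w w') (hab : a < b)
    (hr : 0 < r) (hu : ∀ x ∈ Icc a b, 0 ≤ u x) : 0 ≤ w a ∧ 0 ≤ w b := by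
  have ha := left_mem_Icc.2 hab.le
  have hb := right_mem_Icc.2 hab.le
  set E := Real.exp (r * (b - a)) with hE
  have hE1 : 1 < E := Real.one_lt_exp_iff.2 (mul_pos hr (sub_pos.2 hab))
  have hle : w a ≤ E * w b := by
    have := h.mul_sub_deriv_le_exp_mul hu ha hb hab.le
    rw [h.deriv_left, h.deriv_right, sub_zero, sub_zero, mul_left_comm] at this
    exact le_of_mul_le_mul_left this hr
  have hge : w b ≤ E * w a := by
    have := h.of_neg.mul_sub_deriv_le_exp_mul hu ha hb hab.le
    rw [h.deriv_left, h.deriv_right, sub_zero, sub_zero, neg_mul r (b - a), Real.exp_neg, ← hE,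
      inv_mul_eq_div, le_div_iff₀ (by linarith)] at this
    exact le_of_mul_le_mul_left (by linarith) hr
  have hnonneg {p q : ℝ} (hp : p ≤ E * q) (hq : q ≤ E * p) : 0 ≤ p := by
    have hE2 : 0 < E ^ 2 - 1 := by nlinarith
    refine nonneg_of_mul_nonneg_right ?_ hE2
    linarith [hp.trans (mul_le_mul_of_nonneg_left hq (by linarith))]
  exact ⟨hnonneg hle hge, hnonneg hge hle⟩

theorem deriv_sq_le (h : NeumannResolvent a b t u w w') (hab : a < b) (ht : 0 < t)
    (hu : ∀ x ∈ Icc a b, 0 ≤ u x) {x : ℝ} (hx : x ∈ Icc a b) : w' x ^ 2 ≤ t * w x ^ 2 := by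
  obtain ⟨r, hr, rfl⟩ : ∃ r, 0 < r ∧ r ^ 2 = t := ⟨√t, Real.sqrt_pos.2 ht, Real.sq_sqrt ht.le⟩
  obtain ⟨hwa, hwb⟩ := h.nonneg_endpoints hab hr hu
  have hsub : 0 ≤ r * w x - w' x := by
    have := h.mul_sub_deriv_le_exp_mul hu (left_mem_Icc.2 hab.le) hx hx.1
    rw [h.deriv_left, sub_zero] at this
    exact nonneg_of_mul_nonneg_right ((mul_nonneg hr.le hwa).trans this) (Real.exp_pos _)
  have hadd : 0 ≤ r * w x + w' x := by
    have := h.of_neg.mul_sub_deriv_le_exp_mul hu hx (right_mem_Icc.2 hab.le) hx.2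
    rw [h.deriv_right, sub_zero] at this
    have : 0 ≤ Real.exp (-r * (b - x)) * (r * w b) := by positivity
    linarith
  nlinarith [mul_nonneg hsub hadd]

theorem integral_deriv_sq_div (h : NeumannResolvent a b t u w w') (ht : t ≠ 0)
    (hu : Continuous u) : ∫ x in a..b, w' x ^ 2 / t =
      (∫ x in a..b, u x * w x) - ∫ x in a..b, w x ^ 2 := by
  have hw := h.continuous
  have hw' := h.continuous_deriv
  have hint {f : ℝ → ℝ} (hf : Continuous f) := hf.intervalIntegrable (μ := volume) a b
  have hflux : ∫ x in a..b, (w' x ^ 2 / t + (w x ^ 2 - u x * w x)) = 0 := by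
    rw [intervalIntegral.integral_eq_sub_of_hasDerivAt (f := fun x => w x * w' x / t)
      (fun x _ => ?_) (hint (by fun_prop)), h.deriv_left, h.deriv_right]
    · simp
    · refine (((h.hasDerivAt x).mul (h.hasDerivAt_deriv x)).div_const t).congr_deriv ?_
      field_simp
  rw [intervalIntegral.integral_add (hint (by fun_prop)) (hint (by fun_prop)),
    intervalIntegral.integral_sub (hint (by fun_prop)) (hint (by fun_prop))] at hflux
  linarith

theorem integral_sawtooth_add (h : NeumannResolvent a b t u w w') (ht : t ≠ 0)
    (hu : Continuous u) {x₀ : ℝ} (hx₀ : x₀ ∈ Icc a b) :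
    (∫ x in a..b, sawtooth a b x₀ x * (u x * w' x)) + 1 / 2 * ∫ x in a..b, u x * w x =
      (b - a) / 2 * (w x₀ ^ 2 - w' x₀ ^ 2 / t) +
        ((∫ x in a..b, u x * w x) - ∫ x in a..b, w x ^ 2) := by
  have hw := h.continuous
  have hw' := h.continuous_deriv
  have hint {f : ℝ → ℝ} (hf : Continuous f) := hf.intervalIntegrable (μ := volume) a b
  have hderiv (x : ℝ) :
      HasDerivAt (fun y => 1 / 2 * (w y ^ 2 - w' y ^ 2 / t)) (u x * w' x) x := by
    refine ((((h.hasDerivAt x).pow 2).sub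
      (((h.hasDerivAt_deriv x).pow 2).div_const t)).const_mul (1 / 2 : ℝ)).congr_deriv ?_
    field_simp
    ring
  rw [integral_sawtooth_mul_deriv hx₀ (fun x _ => hderiv x) (hint (hu.mul hw')),
    intervalIntegral.integral_const_mul,
    intervalIntegral.integral_sub (hint (by fun_prop)) (hint (by fun_prop)),
    h.integral_deriv_sq_div ht hu]
  ring

theorem integral_sawtooth_add_mem_Icc (h : NeumannResolvent a b t u w w') (hab : a < b)
    (ht : 0 < t) (hu : Continuous u) (hu₀ : ∀ x ∈ Icc a b, 0 ≤ u x) {x₀ : ℝ}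
    (hx₀ : x₀ ∈ Icc a b) :
    (∫ x in a..b, sawtooth a b x₀ x * (u x * w' x)) + 1 / 2 * ∫ x in a..b, u x * w x ∈
      Icc 0 ((b - a) / 2 * w x₀ ^ 2 + ((∫ x in a..b, u x * w x) - ∫ x in a..b, w x ^ 2)) := by
  have : 0 < b - a := sub_pos.2 hab
  rw [h.integral_sawtooth_add ht.ne' hu hx₀, ← h.integral_deriv_sq_div ht.ne' hu]
  have henergy : 0 ≤ ∫ x in a..b, w' x ^ 2 / t :=
    intervalIntegral.integral_nonneg hab.le fun x _ => by positivity
  have hjump : 0 ≤ w x₀ ^ 2 - w' x₀ ^ 2 / t := by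
    rw [sub_nonneg, div_le_iff₀' ht]
    exact h.deriv_sq_le hab ht hu₀ hx₀
  constructor
  · positivity
  · gcongr
    exact sub_le_self _ (by positivity)

end NeumannResolvent

/-! ### Cosine and sine series -/

/-- The series `∑ e_k φ_k` in the Neumann eigenfunctions, summed pointwise. -/
noncomputable def cosineSeries (a b : ℝ) (e : ℕ → ℝ) (x : ℝ) : ℝ :=
  ∑' k, e k * neumannEigenfunction a b k x

/-- The series in the Dirichlet eigenfunctions with coefficients `e`, summed pointwise. -/
noncomputable def sineSeries (a b : ℝ) (e : ℕ → ℝ) (x : ℝ) : ℝ :=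
  ∑' k, e k * dirichletEigenfunction a b k x

theorem hasSum_integral_mul_tsum {α ι : Type*} [MeasurableSpace α] [Countable ι] {μ : Measure α}
    {f : α → ℝ} {e : ι → ℝ} {g : ι → α → ℝ} {M : ℝ} (hf : Integrable f μ)
    (he : Summable fun k => |e k|) (hg : ∀ k, AEStronglyMeasurable (g k) μ)
    (hM : ∀ k x, |g k x| ≤ M) :
    HasSum (fun k => e k * ∫ x, f x * g k x ∂μ) (∫ x, f x * ∑' k, e k * g k x ∂μ) := by
  have hint (k : ι) : Integrable (fun x => f x * g k x) μ :=
    hf.mul_bdd (hg k) (.of_forall (hM k))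
  have hnorm (k : ι) : ∫ x, ‖e k * (f x * g k x)‖ ∂μ ≤ |e k| * ∫ x, ‖f x‖ * M ∂μ := by
    simp_rw [norm_mul (e k), integral_const_mul]
    refine mul_le_mul_of_nonneg_left ?_ (abs_nonneg _)
    refine integral_mono (hint k).norm (hf.norm.mul_const M) fun x => ?_
    rw [norm_mul]
    exact mul_le_mul_of_nonneg_left (hM k x) (norm_nonneg _)
  simp_rw [← tsum_mul_left, ← integral_const_mul, mul_left_comm (f _)]
  refine hasSum_integral_of_summable_integral_norm (fun k => (hint k).const_mul (e k)) ?_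
  exact (he.mul_right _).of_nonneg_of_le (fun k => integral_nonneg fun x => norm_nonneg _) hnorm

section Series

variable {a b : ℝ} {e : ℕ → ℝ}

theorem norm_mul_neumannEigenfunction_le (a b : ℝ) (e : ℕ → ℝ) (k : ℕ) (x : ℝ) :
    ‖e k * neumannEigenfunction a b k x‖ ≤ |e k| * Real.sqrt (2 / (b - a)) := by
  rw [norm_mul]
  exact mul_le_mul_of_nonneg_left (abs_neumannEigenfunction_le a b k x) (abs_nonneg _)

theorem norm_mul_dirichletEigenfunction_le (a b : ℝ) (e : ℕ → ℝ) (k : ℕ) (x : ℝ) :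
    ‖e k * dirichletEigenfunction a b k x‖ ≤ |e k| * Real.sqrt (2 / (b - a)) := by
  rw [norm_mul]
  exact mul_le_mul_of_nonneg_left (abs_dirichletEigenfunction_le a b k x) (abs_nonneg _)

theorem summable_mul_neumannEigenfunction (he : Summable fun k => |e k|) (x : ℝ) :
    Summable fun k => e k * neumannEigenfunction a b k x :=
  (he.mul_right _).of_norm_bounded fun k => norm_mul_neumannEigenfunction_le a b e k x

theorem continuous_cosineSeries (he : Summable fun k => |e k|) :
    Continuous (cosineSeries a b e) :=
  continuous_tsum (fun k => (continuous_neumannEigenfunction a b k).const_mul _)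
    (he.mul_right _) fun k x => norm_mul_neumannEigenfunction_le a b e k x

theorem hasDerivAt_cosineSeries (he : Summable fun k => |e k|)
    (he' : Summable fun k => |neumannFreq a b k * e k|) (x : ℝ) :
    HasDerivAt (cosineSeries a b e) (sineSeries a b (fun k => -(neumannFreq a b k * e k)) x) x := by
  refine hasDerivAt_tsum (g := fun k y => e k * neumannEigenfunction a b k y)
    (g' := fun k y => -(neumannFreq a b k * e k) * dirichletEigenfunction a b k y)
    (he'.mul_right (Real.sqrt (2 / (b - a)))) (y₀ := 0) (fun k y => ?_) (fun k y => ?_)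
    (summable_mul_neumannEigenfunction he 0) x
  · refine ((hasDerivAt_neumannEigenfunction a b k y).const_mul (e k)).congr_deriv ?_
    ring
  · rw [← abs_neg]
    exact norm_mul_dirichletEigenfunction_le a b (fun k => -(neumannFreq a b k * e k)) k y

theorem hasDerivAt_sineSeries (he : Summable fun k => |e k|)
    (he' : Summable fun k => |neumannFreq a b k * e k|) (x : ℝ) :
    HasDerivAt (sineSeries a b e) (cosineSeries a b (fun k => neumannFreq a b k * e k) x) x := by
  refine hasDerivAt_tsum (g := fun k y => e k * dirichletEigenfunction a b k y)
    (he'.mul_right (Real.sqrt (2 / (b - a)))) (y₀ := 0) (fun k y => ?_)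
    (norm_mul_neumannEigenfunction_le a b _)
    ((he.mul_right _).of_norm_bounded fun k => norm_mul_dirichletEigenfunction_le a b e k 0) x
  refine ((hasDerivAt_dirichletEigenfunction a b k y).const_mul (e k)).congr_deriv ?_
  ring

theorem hasSum_integral_mul_cosineSeries (hab : a ≤ b) {f : ℝ → ℝ}
    (hf : IntervalIntegrable f volume a b) (he : Summable fun k => |e k|) :
    HasSum (fun k => e k * ∫ x in a..b, f x * neumannEigenfunction a b k x)
      (∫ x in a..b, f x * cosineSeries a b e x) := by
  simp_rw [intervalIntegral.integral_of_le hab]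
  exact hasSum_integral_mul_tsum ((intervalIntegrable_iff_integrableOn_Ioc_of_le hab).1 hf) he
    (fun k => (continuous_neumannEigenfunction a b k).aestronglyMeasurable)
    (abs_neumannEigenfunction_le a b)

theorem hasSum_integral_mul_sineSeries (hab : a ≤ b) {f : ℝ → ℝ}
    (hf : IntervalIntegrable f volume a b) (he : Summable fun k => |e k|) :
    HasSum (fun k => e k * ∫ x in a..b, f x * dirichletEigenfunction a b k x)
      (∫ x in a..b, f x * sineSeries a b e x) := by
  simp_rw [intervalIntegral.integral_of_le hab]
  exact hasSum_integral_mul_tsum ((intervalIntegrable_iff_integrableOn_Ioc_of_le hab).1 hf) he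
    (fun k => (continuous_dirichletEigenfunction a b k).aestronglyMeasurable)
    (abs_dirichletEigenfunction_le a b)

theorem integral_cosineSeries_mul_neumannEigenfunction (hab : a < b)
    (he : Summable fun k => |e k|) (j : ℕ) :
    ∫ x in a..b, cosineSeries a b e x * neumannEigenfunction a b j x = e j := by
  have h := hasSum_integral_mul_cosineSeries hab.le
    ((continuous_neumannEigenfunction a b j).intervalIntegrable a b) he
  simp_rw [integral_neumannEigenfunction_mul hab, mul_ite, mul_one, mul_zero] at h
  simp_rw [mul_comm (cosineSeries a b e _)]
  rw [← h.tsum_eq, tsum_ite_eq']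

theorem hasSum_integral_cosineSeries_mul (hab : a < b) {c : ℕ → ℝ} (hc : Summable fun k => |c k|)
    (he : Summable fun k => |e k|) :
    HasSum (fun k => e k * c k) (∫ x in a..b, cosineSeries a b c x * cosineSeries a b e x) := by
  simpa only [integral_cosineSeries_mul_neumannEigenfunction hab hc] using
    hasSum_integral_mul_cosineSeries hab.le
      ((continuous_cosineSeries (a := a) (b := b) hc).intervalIntegrable a b) he

end Series

/-! ### Resolvent multipliers -/

/-- The Fourier multiplier of the resolvent `(1 - t⁻¹ ∂ₓₓ)⁻¹` at the eigenvalue `l`. -/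
noncomputable def resolventFactor (t l : ℝ) : ℝ := t / (t + l)

section ResolventFactor

variable {t l : ℝ}

theorem resolventFactor_mem_Icc (ht : 0 < t) (hl : 0 ≤ l) : resolventFactor t l ∈ Icc 0 1 :=
  ⟨by unfold resolventFactor; positivity, div_le_one_of_le₀ (by linarith) (by linarith)⟩

theorem one_sub_resolventFactor (h : t + l ≠ 0) : 1 - resolventFactor t l = l / (t + l) := by
  rw [resolventFactor]
  field_simp
  ring

theorem mul_resolventFactor (h : t + l ≠ 0) :
    l * resolventFactor t l = t * (1 - resolventFactor t l) := by
  rw [one_sub_resolventFactor h, resolventFactor]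
  ring

theorem mul_resolventFactor_sq_le (ht : 0 < t) (l : ℝ) : l * resolventFactor t (l ^ 2) ≤ 1 + t := by
  rw [resolventFactor, mul_div_assoc', div_le_iff₀ (by positivity)]
  nlinarith [mul_nonneg ht.le (sq_nonneg (l - 1)), mul_nonneg ht.le (sq_nonneg l), sq_nonneg l,
    sq_nonneg t]

open Filter Topology in
theorem tendsto_resolventFactor_atTop (l : ℝ) :
    Tendsto (fun t => resolventFactor t l) atTop (𝓝 1) := by
  have hdiv : Tendsto (fun t : ℝ => 1 - l / (t + l)) atTop (𝓝 1) := by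
    simpa using tendsto_const_nhds.sub
      ((tendsto_const_nhds (x := l)).div_atTop (tendsto_atTop_add_const_right _ l tendsto_id))
  refine hdiv.congr' ?_
  filter_upwards [eventually_gt_atTop (-l)] with t ht
  linarith [one_sub_resolventFactor (show t + l ≠ 0 by linarith)]

variable {ι : Type*} {f m : ι → ℝ}

theorem summable_abs_resolventFactor_mul (ht : 0 < t) (hm : ∀ k, 0 ≤ m k)
    (hf : Summable fun k => |f k|) : Summable fun k => |resolventFactor t (m k) * f k| := by
  refine hf.of_nonneg_of_le (fun k => abs_nonneg _) fun k => ?_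
  obtain ⟨hρ₀, hρ₁⟩ := resolventFactor_mem_Icc ht (hm k)
  rw [abs_mul, abs_of_nonneg hρ₀]
  exact mul_le_of_le_one_left (abs_nonneg _) hρ₁

open Filter Topology in
theorem tendsto_tsum_resolventFactor_pow_mul (n : ℕ) (hm : ∀ k, 0 ≤ m k)
    (hf : Summable fun k => |f k|) :
    Tendsto (fun t => ∑' k, resolventFactor t (m k) ^ n * f k) atTop (𝓝 (∑' k, f k)) := by
  refine tendsto_tsum_of_dominated_convergence hf (fun k => ?_) ?_
  · simpa using ((tendsto_resolventFactor_atTop (m k)).pow n).mul_const (f k)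
  · filter_upwards [eventually_gt_atTop 0] with t ht k
    obtain ⟨hρ₀, hρ₁⟩ := resolventFactor_mem_Icc ht (hm k)
    rw [norm_mul, Real.norm_of_nonneg (pow_nonneg hρ₀ n)]
    exact mul_le_of_le_one_left (norm_nonneg _) (pow_le_one₀ hρ₀ hρ₁)

end ResolventFactor

theorem tsum_rpow_mul_nonneg {ι : Type*} [Countable ι] {s : ℝ} (hs : s ∈ Ioo (0 : ℝ) 1)
    {l d : ι → ℝ} (hl : ∀ k, 0 ≤ l k) (hsum : Summable fun k => l k ^ s * |d k|)
    (h : ∀ t, 0 < t → 0 ≤ ∑' k, l k / (t + l k) * d k) :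
    0 ≤ ∑' k, l k ^ s * d k := by
  -- `l ^ s` is an average over `t > 0` of positive multiples of `l / (t + l)`.
  obtain ⟨μ, hμ⟩ := Real.exists_measure_rpow_eq_integral_rpowIntegrand₀₁ hs
  have hpow (k : ι) (c : ℝ) :
      ∫ t in Ioi 0, Real.rpowIntegrand₀₁ s t (l k) * c ∂μ = l k ^ s * c := by
    rw [integral_mul_const, ← (hμ _ (hl k)).2]
  have hnorm (k : ι) : ∫ t in Ioi 0, ‖Real.rpowIntegrand₀₁ s t (l k) * d k‖ ∂μ =
      l k ^ s * |d k| := by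
    rw [← hpow k]
    refine setIntegral_congr_fun measurableSet_Ioi fun t ht => ?_
    rw [norm_mul, Real.norm_of_nonneg (Real.rpowIntegrand₀₁_nonneg hs.1 (le_of_lt ht) (hl k)),
      Real.norm_eq_abs]
  have hswap := hasSum_integral_of_summable_integral_norm (μ := μ.restrict (Ioi 0))
    (F := fun k t => Real.rpowIntegrand₀₁ s t (l k) * d k)
    (fun k => (hμ _ (hl k)).1.mul_const _) (hsum.congr fun k => (hnorm k).symm)
  simp_rw [hpow] at hswap
  rw [hswap.tsum_eq]
  refine setIntegral_nonneg measurableSet_Ioi fun t ht => ?_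
  have hterm (k : ι) : Real.rpowIntegrand₀₁ s t (l k) * d k =
      t ^ (s - 1) * (l k / (t + l k) * d k) := by
    rw [Real.rpowIntegrand₀₁_eq_pow_div hs (le_of_lt ht) (hl k)]
    ring
  simp_rw [hterm, tsum_mul_left]
  exact mul_nonneg (Real.rpow_nonneg (le_of_lt ht) _) (h t ht)

/-! ### The virial inequality in Fourier coefficients -/

/-- The coefficients of `ψ u` in the Dirichlet eigenfunctions, `ψ` being the sawtooth weight. -/
noncomputable def sawtoothCoeff (a b x₀ : ℝ) (u : ℝ → ℝ) (k : ℕ) : ℝ :=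
  ∫ x in a..b, sawtooth a b x₀ x * u x * dirichletEigenfunction a b k x

/-- The `k`-th term of `-∫ ψ u u' - ½ ∫ u²`, `ψ` being the sawtooth weight, when the factors `u'`
and (one) `u` are expanded as `u = ∑ c_k φ_k`. -/
noncomputable def virialTerm (a b x₀ : ℝ) (c : ℕ → ℝ) (k : ℕ) : ℝ :=
  neumannFreq a b k * c k * sawtoothCoeff a b x₀ (cosineSeries a b c) k - c k ^ 2 / 2

theorem memLp_sawtooth_mul {a b : ℝ} (x₀ : ℝ) {f : ℝ → ℝ} {p : ℝ≥0∞}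
    (hf : MemLp f p (volume.restrict (Ioo a b))) :
    MemLp (fun x => sawtooth a b x₀ x * f x) p (volume.restrict (Ioo a b)) := by
  refine hf.of_le_mul (c := b - a)
    ((measurable_sawtooth a b x₀).aestronglyMeasurable.mul hf.1) ?_
  filter_upwards [ae_restrict_mem measurableSet_Ioo] with x hx
  rw [norm_mul]
  exact mul_le_mul_of_nonneg_right (abs_sawtooth_le (Ioo_subset_Icc_self hx)) (norm_nonneg _)

section Virial

variable {a b t : ℝ} {c : ℕ → ℝ}

theorem summable_abs_neumannFreq_mul_resolventFactor_mul (hab : a ≤ b) (ht : 0 < t)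
    (hc : Summable fun k => |c k|) : Summable fun k =>
      |neumannFreq a b k * (resolventFactor t (neumannEigenvalue a b k) * c k)| := by
  refine (hc.mul_left (1 + t)).of_nonneg_of_le (fun k => abs_nonneg _) fun k => ?_
  have hμ := neumannFreq_nonneg hab k
  have hρ := (resolventFactor_mem_Icc ht (neumannEigenvalue_nonneg a b k)).1
  rw [← mul_assoc, abs_mul, abs_of_nonneg (mul_nonneg hμ hρ)]
  exact mul_le_mul_of_nonneg_right (mul_resolventFactor_sq_le ht _) (abs_nonneg _)

theorem neumannResolvent_cosineSeries (hab : a ≤ b) (ht : 0 < t) (hc : Summable fun k => |c k|) :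
    NeumannResolvent a b t (cosineSeries a b c)
      (cosineSeries a b fun k => resolventFactor t (neumannEigenvalue a b k) * c k)
      (sineSeries a b fun k =>
        -(neumannFreq a b k * (resolventFactor t (neumannEigenvalue a b k) * c k))) := by
  set e : ℕ → ℝ := fun k => resolventFactor t (neumannEigenvalue a b k) * c k with he_def
  have he : Summable fun k => |e k| :=
    summable_abs_resolventFactor_mul ht (neumannEigenvalue_nonneg a b) hc
  have he' := summable_abs_neumannFreq_mul_resolventFactor_mul hab ht hc
  have heq (k : ℕ) : neumannFreq a b k * -(neumannFreq a b k * e k) = t * (e k - c k) := by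
    have hρ := mul_resolventFactor (t := t) (l := neumannEigenvalue a b k)
      (add_pos_of_pos_of_nonneg ht (neumannEigenvalue_nonneg a b k)).ne'
    simp only [he_def]
    linear_combination -c k * hρ +
      resolventFactor t (neumannEigenvalue a b k) * c k * neumannEigenvalue_eq_sq a b k
  have he'' : Summable fun k => |neumannFreq a b k * -(neumannFreq a b k * e k)| := by
    simp_rw [heq]
    exact ((he.of_abs.sub hc.of_abs).mul_left t).abs
  refine ⟨hasDerivAt_cosineSeries he he', fun x => ?_, ?_, ?_⟩
  · refine (hasDerivAt_sineSeries (by simpa only [abs_neg] using he') he'' x).congr_deriv ?_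
    simp only [cosineSeries, heq]
    rw [← (summable_mul_neumannEigenfunction he x).tsum_sub
      (summable_mul_neumannEigenfunction hc x), ← tsum_mul_left]
    exact tsum_congr fun k => by ring
  · simp [sineSeries, dirichletEigenfunction_left]
  · simp [sineSeries, dirichletEigenfunction_right]

theorem hasSum_sq_of_summable_abs (hab : a < b) (hc : Summable fun k => |c k|) :
    HasSum (fun k => c k ^ 2) (∫ x in a..b, cosineSeries a b c x ^ 2) := by
  simpa only [sq] using hasSum_integral_cosineSeries_mul hab hc hc

theorem tsum_resolventFactor_mul_virialTerm (hab : a < b) (ht : 0 < t)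
    (hc : Summable fun k => |c k|) (x₀ : ℝ) :
    ∑' k, resolventFactor t (neumannEigenvalue a b k) * virialTerm a b x₀ c k =
      -((∫ x in a..b, sawtooth a b x₀ x * (cosineSeries a b c x * sineSeries a b (fun k =>
          -(neumannFreq a b k * (resolventFactor t (neumannEigenvalue a b k) * c k))) x)) +
        1 / 2 * ∫ x in a..b, cosineSeries a b c x * cosineSeries a b
          (fun k => resolventFactor t (neumannEigenvalue a b k) * c k) x) := by
  set e : ℕ → ℝ := fun k => resolventFactor t (neumannEigenvalue a b k) * c k with he_def
  have hψu : IntervalIntegrable (fun x => sawtooth a b x₀ x * cosineSeries a b c x) volume a b := by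
    rw [intervalIntegrable_iff_integrableOn_Ioo_of_le hab.le, IntegrableOn,
      ← memLp_one_iff_integrable]
    refine memLp_sawtooth_mul x₀ (memLp_one_iff_integrable.2 ?_)
    exact (intervalIntegrable_iff_integrableOn_Ioo_of_le hab.le).1
      ((continuous_cosineSeries hc).intervalIntegrable a b)
  have hderiv := hasSum_integral_mul_sineSeries hab.le hψu
    (e := fun k => -(neumannFreq a b k * e k)) (by
      simpa only [abs_neg] using summable_abs_neumannFreq_mul_resolventFactor_mul hab.le ht hc)
  have hsq := hasSum_integral_cosineSeries_mul hab hc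
    (summable_abs_resolventFactor_mul ht (neumannEigenvalue_nonneg a b) hc)
  simp_rw [← mul_assoc (sawtooth a b x₀ _)]
  rw [← (hderiv.add (hsq.mul_left (1 / 2))).neg.tsum_eq]
  refine tsum_congr fun k => ?_
  simp only [virialTerm, sawtoothCoeff, he_def]
  ring

theorem neg_tsum_resolventFactor_mul_virialTerm_mem_Icc (hab : a < b) (ht : 0 < t)
    (hc : Summable fun k => |c k|) (hu : ∀ x ∈ Icc a b, 0 ≤ cosineSeries a b c x) {x₀ : ℝ}
    (hx₀ : x₀ ∈ Icc a b) :
    -∑' k, resolventFactor t (neumannEigenvalue a b k) * virialTerm a b x₀ c k ∈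
      Icc 0 ((b - a) / 2 * cosineSeries a b
          (fun k => resolventFactor t (neumannEigenvalue a b k) * c k) x₀ ^ 2 +
        ((∑' k, resolventFactor t (neumannEigenvalue a b k) ^ 1 * c k ^ 2) -
          ∑' k, resolventFactor t (neumannEigenvalue a b k) ^ 2 * c k ^ 2)) := by
  have he := summable_abs_resolventFactor_mul ht (neumannEigenvalue_nonneg a b) hc
  have key := (neumannResolvent_cosineSeries hab.le ht hc).integral_sawtooth_add_mem_Icc hab ht
    (continuous_cosineSeries hc) hu hx₀
  rw [← (hasSum_integral_cosineSeries_mul hab hc he).tsum_eq,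
    ← (hasSum_sq_of_summable_abs hab he).tsum_eq] at key
  rw [tsum_resolventFactor_mul_virialTerm hab ht hc, neg_neg,
    ← (hasSum_integral_cosineSeries_mul hab hc he).tsum_eq]
  simpa only [pow_one, mul_pow, mul_assoc, sq (c _)] using key

open Filter Topology in
theorem tsum_virialTerm_eq_zero (hab : a < b) (hc : Summable fun k => |c k|)
    (hu : ∀ x ∈ Icc a b, 0 ≤ cosineSeries a b c x) {x₀ : ℝ} (hx₀ : x₀ ∈ Icc a b)
    (hu₀ : cosineSeries a b c x₀ = 0) (hd : Summable fun k => |virialTerm a b x₀ c k|) :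
    ∑' k, virialTerm a b x₀ c k = 0 := by
  have hl := neumannEigenvalue_nonneg a b
  have hlim := tendsto_tsum_resolventFactor_pow_mul 1 hl hd
  have hc₂ := (hasSum_sq_of_summable_abs hab hc).summable.abs
  have hpoint : Tendsto (fun t => cosineSeries a b
      (fun k => resolventFactor t (neumannEigenvalue a b k) * c k) x₀) atTop (𝓝 0) := by
    have := tendsto_tsum_resolventFactor_pow_mul 1 hl
      (summable_mul_neumannEigenfunction (a := a) (b := b) hc x₀).abs
    rw [← hu₀]
    simpa only [cosineSeries, mul_assoc, pow_one] using this
  have hupper := ((hpoint.pow 2).const_mul ((b - a) / 2)).add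
    ((tendsto_tsum_resolventFactor_pow_mul 1 hl hc₂).sub
      (tendsto_tsum_resolventFactor_pow_mul 2 hl hc₂))
  rw [sub_self (∑' k, c k ^ 2), add_zero, zero_pow two_ne_zero, mul_zero] at hupper
  have hmem : ∀ᶠ t in atTop, _ := (eventually_gt_atTop (0 : ℝ)).mono fun t ht =>
    neg_tsum_resolventFactor_mul_virialTerm_mem_Icc hab ht hc hu hx₀
  have hzero := tendsto_of_tendsto_of_tendsto_of_le_of_le' tendsto_const_nhds hupper
    (hmem.mono fun t ht => ht.1) (hmem.mono fun t ht => ht.2)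
  simp only [pow_one] at hlim
  exact neg_eq_zero.1 (tendsto_nhds_unique hlim.neg hzero)

theorem tsum_rpow_mul_virialTerm_nonneg (hab : a < b) {s : ℝ} (hs : s ∈ Ioo (0 : ℝ) 1)
    (hc : Summable fun k => |c k|) (hu : ∀ x ∈ Icc a b, 0 ≤ cosineSeries a b c x) {x₀ : ℝ}
    (hx₀ : x₀ ∈ Icc a b) (hu₀ : cosineSeries a b c x₀ = 0)
    (hd : Summable fun k => |virialTerm a b x₀ c k|)
    (hds : Summable fun k => neumannEigenvalue a b k ^ s * |virialTerm a b x₀ c k|) :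
    0 ≤ ∑' k, neumannEigenvalue a b k ^ s * virialTerm a b x₀ c k := by
  have hl := neumannEigenvalue_nonneg a b
  refine tsum_rpow_mul_nonneg hs hl hds fun t ht => ?_
  have hle := (neg_tsum_resolventFactor_mul_virialTerm_mem_Icc hab ht hc hu hx₀).1
  have hsub : ∑' k, neumannEigenvalue a b k / (t + neumannEigenvalue a b k) *
      virialTerm a b x₀ c k = (∑' k, virialTerm a b x₀ c k) -
        ∑' k, resolventFactor t (neumannEigenvalue a b k) * virialTerm a b x₀ c k := by
    rw [← hd.of_abs.tsum_sub (summable_abs_resolventFactor_mul ht hl hd).of_abs]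
    refine tsum_congr fun k => ?_
    rw [← one_sub_resolventFactor (add_pos_of_pos_of_nonneg ht (hl k)).ne']
    ring
  rwa [hsub, tsum_virialTerm_eq_zero hab hc hu hx₀ hu₀ hd, zero_sub]

end Virial

/-! ### Expansions in `L²` -/

theorem summable_smul_of_orthonormal {ι E : Type*} [NormedAddCommGroup E] [InnerProductSpace ℝ E]
    [CompleteSpace E] {f : ι → E} (hf : Orthonormal ℝ f) {e : ι → ℝ}
    (he : Summable fun k => e k ^ 2) : Summable fun k => e k • f k := by
  simpa using (hf.orthogonalFamily.summable_iff_norm_sq_summable e).2 (by simpa using he)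

section L2

variable {α : Type*} [MeasurableSpace α] {μ : Measure α}

theorem inner_toLp_eq_integral {f : α → ℝ} (hf : MemLp f 2 μ) (G : Lp ℝ 2 μ) :
    inner ℝ (hf.toLp f) G = ∫ x, f x * G x ∂μ := by
  rw [L2.inner_def]
  refine integral_congr_ae ?_
  filter_upwards [hf.coeFn_toLp] with x hx
  rw [hx, RCLike.inner_apply, conj_trivial, mul_comm]

theorem inner_toLp_toLp_eq_integral {f g : α → ℝ} (hf : MemLp f 2 μ) (hg : MemLp g 2 μ) :
    inner ℝ (hf.toLp f) (hg.toLp g) = ∫ x, f x * g x ∂μ := by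
  rw [inner_toLp_eq_integral]
  refine integral_congr_ae ?_
  filter_upwards [hg.coeFn_toLp] with x hx
  rw [hx]

theorem hasSum_integral_mul_of_hasSum_toLp {ι : Type*} {g : ι → α → ℝ}
    (hg : ∀ k, MemLp (g k) 2 μ) {e : ι → ℝ} {G : Lp ℝ 2 μ}
    (hG : HasSum (fun k => e k • (hg k).toLp (g k)) G) {f : α → ℝ} (hf : MemLp f 2 μ) :
    HasSum (fun k => e k * ∫ x, f x * g k x ∂μ) (∫ x, f x * G x ∂μ) := by
  have h := hG.mapL (innerSL ℝ (hf.toLp f))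
  simp only [innerSL_apply_apply, inner_smul_right, inner_toLp_toLp_eq_integral] at h
  rwa [inner_toLp_eq_integral] at h

end L2

theorem memLp_of_continuous {a b : ℝ} {f : ℝ → ℝ} (hf : Continuous f) {p : ℝ≥0∞} :
    MemLp f p (volume.restrict (Ioo a b)) := by
  obtain ⟨C, hC⟩ := isCompact_Icc.exists_bound_of_continuousOn (s := Icc a b) hf.continuousOn
  refine MemLp.of_bound hf.aestronglyMeasurable C ?_
  filter_upwards [ae_restrict_mem measurableSet_Ioo] with x hx
  exact hC x (Ioo_subset_Icc_self hx)

theorem memLp_dirichletEigenfunction (a b : ℝ) (k : ℕ) :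
    MemLp (dirichletEigenfunction a b k) 2 (volume.restrict (Ioo a b)) :=
  memLp_of_continuous (continuous_dirichletEigenfunction a b k)

/-- The series `∑ e_k φ_k` in the Neumann eigenfunctions, summed in `L²(a, b)`. -/
noncomputable def cosineSeriesLp (a b : ℝ) (e : ℕ → ℝ) : Lp ℝ 2 (volume.restrict (Ioo a b)) :=
  ∑' k, e k • (memLp_neumannEigenfunction a b k).toLp (neumannEigenfunction a b k)

/-- The series in the Dirichlet eigenfunctions with coefficients `e`, summed in `L²(a, b)`. -/
noncomputable def sineSeriesLp (a b : ℝ) (e : ℕ → ℝ) : Lp ℝ 2 (volume.restrict (Ioo a b)) :=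
  ∑' k, e k • (memLp_dirichletEigenfunction a b k).toLp (dirichletEigenfunction a b k)

section Expansion

variable {a b : ℝ} {e : ℕ → ℝ}

theorem orthonormal_neumannEigenfunction (hab : a < b) :
    Orthonormal ℝ fun k =>
      (memLp_neumannEigenfunction a b k).toLp (neumannEigenfunction a b k) := by
  refine orthonormal_iff_ite.2 fun j k => ?_
  rw [inner_toLp_toLp_eq_integral, integral_Ioo_eq_intervalIntegral hab.le,
    integral_neumannEigenfunction_mul hab]

theorem orthonormal_dirichletEigenfunction (hab : a < b) :
    Orthonormal ℝ fun k => (memLp_dirichletEigenfunction a b (k + 1)).toLp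
      (dirichletEigenfunction a b (k + 1)) := by
  refine orthonormal_iff_ite.2 fun j k => ?_
  rw [inner_toLp_toLp_eq_integral, integral_Ioo_eq_intervalIntegral hab.le,
    integral_dirichletEigenfunction_mul hab _ k.succ_ne_zero]
  simp

theorem hasSum_integral_mul_cosineSeriesLp (hab : a < b) (he : Summable fun k => e k ^ 2)
    {f : ℝ → ℝ} (hf : MemLp f 2 (volume.restrict (Ioo a b))) :
    HasSum (fun k => e k * ∫ x in a..b, f x * neumannEigenfunction a b k x)
      (∫ x in Ioo a b, f x * cosineSeriesLp a b e x) := by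
  simp_rw [← integral_Ioo_eq_intervalIntegral hab.le]
  exact hasSum_integral_mul_of_hasSum_toLp _
    (summable_smul_of_orthonormal (orthonormal_neumannEigenfunction hab) he).hasSum hf

theorem hasSum_integral_mul_sineSeriesLp (hab : a < b) (he : Summable fun k => e k ^ 2)
    {f : ℝ → ℝ} (hf : MemLp f 2 (volume.restrict (Ioo a b))) :
    HasSum (fun k => e k * ∫ x in a..b, f x * dirichletEigenfunction a b k x)
      (∫ x in Ioo a b, f x * sineSeriesLp a b e x) := by
  simp_rw [← integral_Ioo_eq_intervalIntegral hab.le]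
  refine hasSum_integral_mul_of_hasSum_toLp (memLp_dirichletEigenfunction a b) (Summable.hasSum ?_)
    hf
  rw [← summable_nat_add_iff 1]
  exact summable_smul_of_orthonormal (orthonormal_dirichletEigenfunction hab)
    ((summable_nat_add_iff 1).2 he)

theorem integral_cosineSeriesLp_mul_neumannEigenfunction (hab : a < b)
    (he : Summable fun k => e k ^ 2) (j : ℕ) :
    ∫ x in Ioo a b, cosineSeriesLp a b e x * neumannEigenfunction a b j x = e j := by
  have h := hasSum_integral_mul_cosineSeriesLp hab he (memLp_neumannEigenfunction a b j)
  simp_rw [integral_neumannEigenfunction_mul hab, mul_ite, mul_one, mul_zero] at h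
  simp_rw [mul_comm (cosineSeriesLp a b e _)]
  rw [← h.tsum_eq, tsum_ite_eq']

theorem integral_sq_cosineSeriesLp (hab : a < b) (he : Summable fun k => e k ^ 2) :
    ∫ x in Ioo a b, cosineSeriesLp a b e x ^ 2 = ∑' k, e k ^ 2 := by
  have h := hasSum_integral_mul_cosineSeriesLp hab he (Lp.memLp (cosineSeriesLp a b e))
  simp_rw [← integral_Ioo_eq_intervalIntegral hab.le,
    integral_cosineSeriesLp_mul_neumannEigenfunction hab he, ← sq] at h
  exact h.tsum_eq.symm

theorem integral_deriv_mul_neumannEigenfunction {φ φ' : ℝ → ℝ}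
    (hφ : ∀ x, HasDerivAt φ (φ' x) x) (hφ' : Continuous φ') (ha : φ a = 0) (hb : φ b = 0) (k : ℕ) :
    ∫ x in a..b, φ' x * neumannEigenfunction a b k x =
      neumannFreq a b k * ∫ x in a..b, φ x * dirichletEigenfunction a b k x := by
  have hparts := intervalIntegral.integral_mul_deriv_eq_deriv_mul
    (fun x _ => hasDerivAt_neumannEigenfunction a b k x) (fun x _ => hφ x)
    (((continuous_dirichletEigenfunction a b k).const_mul _).neg.intervalIntegrable a b)
    (hφ'.intervalIntegrable a b)
  simp_rw [ha, hb, neg_mul, intervalIntegral.integral_neg, mul_assoc,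
    intervalIntegral.integral_const_mul, mul_zero, sub_zero, zero_sub, neg_neg] at hparts
  simpa only [mul_comm] using hparts

theorem hasWeakDerivOn_cosineSeriesLp (hab : a < b) (he : Summable fun k => e k ^ 2)
    (he' : Summable fun k => (neumannFreq a b k * e k) ^ 2) :
    HasWeakDerivOn a b (cosineSeriesLp a b e)
      (sineSeriesLp a b fun k => -(neumannFreq a b k * e k)) := by
  have hloc (G : Lp ℝ 2 (volume.restrict (Ioo a b))) : LocallyIntegrableOn G (Ioo a b) :=
    IntegrableOn.locallyIntegrableOn ((Lp.memLp G).integrable one_le_two)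
  refine ⟨hloc _, hloc _, fun φ hφ _ hsupp => ?_⟩
  have hφ' : Continuous (deriv φ) := hφ.continuous_deriv (by simp)
  have hend {x : ℝ} (hx : x ∉ Ioo a b) : φ x = 0 :=
    image_eq_zero_of_notMem_tsupport fun h => hx (hsupp h)
  have hleft := hasSum_integral_mul_cosineSeriesLp hab he (memLp_of_continuous hφ')
  have hright := (hasSum_integral_mul_sineSeriesLp hab (e := fun k => -(neumannFreq a b k * e k))
    (by simpa only [neg_sq] using he') (memLp_of_continuous hφ.continuous)).neg
  simp_rw [mul_comm _ (deriv φ _), mul_comm _ (φ _)]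
  refine hleft.unique (hright.congr_fun fun k => ?_)
  rw [integral_deriv_mul_neumannEigenfunction
    (fun x => (hφ.differentiable (by simp) x).hasDerivAt) hφ' (hend (by simp)) (hend (by simp))]
  ring

end Expansion

/-! ### Sobolev sequences -/

/-- Membership of a coefficient sequence `c` in `H^r_N(a, b)`: `∑ c_k² (1 + λ_k^r) < ∞`. It allows
`MemHN` to be used for sequences that are not given as the coefficients of a function. -/
def IsSobolevSeq (a b r : ℝ) (c : ℕ → ℝ) : Prop :=
  Summable fun k => c k ^ 2 * (1 + neumannEigenvalue a b k ^ r)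

theorem rpow_le_one_add_rpow {x q p : ℝ} (hx : 0 ≤ x) (hq : 0 ≤ q) (hqp : q ≤ p) :
    x ^ q ≤ 1 + x ^ p := by
  rcases le_total x 1 with h | h
  · linarith [Real.rpow_le_one hx h hq, Real.rpow_nonneg hx p]
  · linarith [Real.rpow_le_rpow_of_exponent_le h hqp]

theorem summable_inv_neumannEigenvalue_rpow (a b : ℝ) {p : ℝ} (hp : 1 / 2 < p) :
    Summable fun k => (neumannEigenvalue a b k ^ p)⁻¹ := by
  refine ((Real.summable_nat_rpow_inv.2 (show 1 < 2 * p by linarith)).mul_left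
    (((Real.pi / (b - a)) ^ 2) ^ p)⁻¹).congr fun k => ?_
  rw [neumannEigenvalue, mul_div_assoc, mul_pow, Real.mul_rpow (by positivity) (by positivity),
    mul_inv, mul_comm, Real.rpow_mul k.cast_nonneg, Real.rpow_two]

theorem abs_le_inv_add_mul_sq {x : ℝ} (hx : 0 < x) (y : ℝ) : |y| ≤ x⁻¹ + x * y ^ 2 := by
  have hsq : 0 ≤ x⁻¹ * (1 - x * |y|) ^ 2 := by positivity
  have hexpand : x⁻¹ * (1 - x * |y|) ^ 2 = x⁻¹ - 2 * |y| + x * y ^ 2 := by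
    rw [← sq_abs y]
    field_simp
    ring
  linarith [abs_nonneg y]

namespace IsSobolevSeq

variable {a b p q : ℝ} {c : ℕ → ℝ}

theorem summable_rpow_mul_sq (hc : IsSobolevSeq a b p c) (hq : 0 ≤ q) (hqp : q ≤ p) :
    Summable fun k => neumannEigenvalue a b k ^ q * c k ^ 2 := by
  refine hc.of_nonneg_of_le (fun k => ?_) fun k => ?_
  · exact mul_nonneg (Real.rpow_nonneg (neumannEigenvalue_nonneg a b k) q) (sq_nonneg _)
  · rw [mul_comm]
    exact mul_le_mul_of_nonneg_left
      (rpow_le_one_add_rpow (neumannEigenvalue_nonneg a b k) hq hqp) (sq_nonneg _)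

theorem mono (hc : IsSobolevSeq a b p c) (hq : 0 ≤ q) (hqp : q ≤ p) : IsSobolevSeq a b q c := by
  refine ((hc.summable_rpow_mul_sq le_rfl (hq.trans hqp)).add
    (hc.summable_rpow_mul_sq hq hqp)).congr fun k => ?_
  rw [Real.rpow_zero]
  ring

theorem summable_sq_rpow_mul (hc : IsSobolevSeq a b p c) (hq : 0 ≤ q) (hqp : 2 * q ≤ p) :
    Summable fun k => (neumannEigenvalue a b k ^ q * c k) ^ 2 := by
  refine (hc.summable_rpow_mul_sq (q := q * 2) (by linarith) (by linarith)).congr fun k => ?_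
  rw [mul_pow, ← Real.rpow_mul_natCast (neumannEigenvalue_nonneg a b k), Nat.cast_two]

theorem summable_sq_neumannFreq_mul_rpow_mul (hc : IsSobolevSeq a b p c) (hq : 0 ≤ q)
    (hqp : 2 * q + 1 ≤ p) :
    Summable fun k => (neumannFreq a b k * (neumannEigenvalue a b k ^ q * c k)) ^ 2 := by
  refine (hc.summable_rpow_mul_sq (q := q * 2 + 1) (by linarith) (by linarith)).congr fun k => ?_
  have hl := neumannEigenvalue_nonneg a b k
  rw [Real.rpow_add_one' hl (by linarith), ← Nat.cast_two (R := ℝ), Real.rpow_mul_natCast hl,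
    mul_pow, mul_pow, ← neumannEigenvalue_eq_sq]
  ring

theorem summable_abs (hc : IsSobolevSeq a b p c) (hab : a ≠ b) (hp : 1 / 2 < p) :
    Summable fun k => |c k| := by
  have hsum := (summable_inv_neumannEigenvalue_rpow a b hp).add
    (hc.summable_rpow_mul_sq (by linarith) le_rfl)
  -- The bound fails at `k = 0`, where `λ₀ = 0`.
  rw [← summable_nat_add_iff 1] at hsum ⊢
  refine hsum.of_nonneg_of_le (fun k => abs_nonneg _) fun k => abs_le_inv_add_mul_sq ?_ _
  have hμ := neumannFreq_ne_zero hab k.succ_ne_zero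
  rw [neumannEigenvalue_eq_sq]
  positivity

theorem update_zero (hc : IsSobolevSeq a b p c) (y : ℝ) :
    IsSobolevSeq a b p (Function.update c 0 y) := by
  rw [IsSobolevSeq, ← summable_nat_add_iff 1] at hc ⊢
  simpa using hc

end IsSobolevSeq

/-! ### The virial inequality -/

/-- `∂ₓ(-Δ)^s u` for `u = ∑ c_k φ_k`. -/
noncomputable def fracLaplacianDeriv (a b s : ℝ) (c : ℕ → ℝ) :
    Lp ℝ 2 (volume.restrict (Ioo a b)) :=
  sineSeriesLp a b fun k => -(neumannFreq a b k * (neumannEigenvalue a b k ^ s * c k))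

section FracLaplacian

variable {a b s : ℝ} {c : ℕ → ℝ} {v : ℝ → ℝ}

theorem fracLaplacianDeriv_update_zero (a b s : ℝ) (c : ℕ → ℝ) (y : ℝ) :
    fracLaplacianDeriv a b s (Function.update c 0 y) = fracLaplacianDeriv a b s c := by
  refine congrArg (sineSeriesLp a b) (funext fun k => ?_)
  rcases k with _ | k
  · simp only [neumannFreq_zero, zero_mul]
  · rw [Function.update_of_ne k.succ_ne_zero]

theorem hasWeakDerivOn_neumannFracLaplacian (hab : a < b) (hs : 0 ≤ s)
    (hv : MemHN a b (2 * s + 1) v) :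
    HasWeakDerivOn a b (neumannFracLaplacian a b s v)
      (fracLaplacianDeriv a b s (neumannCoeff a b v)) :=
  have hc : IsSobolevSeq a b (2 * s + 1) (neumannCoeff a b v) := hv.2
  hasWeakDerivOn_cosineSeriesLp hab (hc.summable_sq_rpow_mul hs (by linarith))
    (hc.summable_sq_neumannFreq_mul_rpow_mul hs le_rfl)

theorem integral_sq_neumannFracLaplacian_half (hab : a < b) (hs : 0 ≤ s) (hv : MemHN a b s v) :
    ∫ x in Ioo a b, neumannFracLaplacian a b (s / 2) v x ^ 2 =
      ∑' k, neumannEigenvalue a b k ^ s * neumannCoeff a b v k ^ 2 := by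
  have hc : IsSobolevSeq a b s (neumannCoeff a b v) := hv.2
  refine (integral_sq_cosineSeriesLp hab
    (hc.summable_sq_rpow_mul (q := s / 2) (by linarith) (by linarith))).trans
    (tsum_congr fun k => ?_)
  rw [mul_pow, ← Real.rpow_mul_natCast (neumannEigenvalue_nonneg a b k), Nat.cast_two,
    div_mul_cancel₀ s two_ne_zero]

theorem hasSum_rpow_mul_virialTerm (hab : a < b) (hs : 0 ≤ s)
    (hc : IsSobolevSeq a b (2 * s + 1) c) (x₀ : ℝ) :
    HasSum (fun k => neumannEigenvalue a b k ^ s * virialTerm a b x₀ c k)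
      (-(∫ x in Ioo a b, sawtooth a b x₀ x * cosineSeries a b c x * fracLaplacianDeriv a b s c x) -
        1 / 2 * ∑' k, neumannEigenvalue a b k ^ s * c k ^ 2) := by
  have hu := continuous_cosineSeries (a := a) (b := b) (hc.summable_abs hab.ne (by linarith))
  have hderiv := hasSum_integral_mul_sineSeriesLp hab
    (e := fun k => -(neumannFreq a b k * (neumannEigenvalue a b k ^ s * c k)))
    (by simpa only [neg_sq] using hc.summable_sq_neumannFreq_mul_rpow_mul hs le_rfl)
    (memLp_sawtooth_mul x₀ (memLp_of_continuous hu))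
  have hsq := (hc.summable_rpow_mul_sq hs (by linarith)).hasSum
  refine (hderiv.neg.sub (hsq.mul_left (1 / 2))).congr_fun fun k => ?_
  rw [virialTerm, sawtoothCoeff]
  ring

theorem half_tsum_le_neg_integral_sawtooth_mul (hab : a < b) (hs : s ∈ Ioo (0 : ℝ) 1)
    (hc : IsSobolevSeq a b (2 * s + 1) c) (hu : ∀ x ∈ Icc a b, 0 ≤ cosineSeries a b c x) {x₀ : ℝ}
    (hx₀ : x₀ ∈ Icc a b) (hu₀ : cosineSeries a b c x₀ = 0) :
    1 / 2 * ∑' k, neumannEigenvalue a b k ^ s * c k ^ 2 ≤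
      -∫ x in Ioo a b, sawtooth a b x₀ x * cosineSeries a b c x * fracLaplacianDeriv a b s c x := by
  have hd := (hasSum_rpow_mul_virialTerm hab le_rfl
    (hc.mono (q := 2 * 0 + 1) (by norm_num) (by linarith [hs.1])) x₀).summable.abs
  have hds := hasSum_rpow_mul_virialTerm hab hs.1.le hc x₀
  have hds' := hds.summable.abs
  simp only [Real.rpow_zero, one_mul] at hd
  simp only [abs_mul, abs_of_nonneg (Real.rpow_nonneg (neumannEigenvalue_nonneg a b _) s)] at hds'
  have hnonneg := tsum_rpow_mul_virialTerm_nonneg hab hs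
    (hc.summable_abs hab.ne (by linarith [hs.1])) hu hx₀ hu₀ hd hds'
  rw [hds.tsum_eq] at hnonneg
  linarith

theorem tsum_le_integral_abs_cosineSeries_mul (hab : a < b) (hs : s ∈ Ioo (0 : ℝ) 1)
    (hc : IsSobolevSeq a b (2 * s + 1) c) (hu : ∀ x ∈ Icc a b, 0 ≤ cosineSeries a b c x) {x₀ : ℝ}
    (hx₀ : x₀ ∈ Icc a b) (hu₀ : cosineSeries a b c x₀ = 0) :
    1 / (2 * (b - a)) * ∑' k, neumannEigenvalue a b k ^ s * c k ^ 2 ≤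
      ∫ x in Ioo a b, |cosineSeries a b c x * fracLaplacianDeriv a b s c x| := by
  have : 0 < b - a := sub_pos.2 hab
  have hmem : MemLp (cosineSeries a b c) 2 (volume.restrict (Ioo a b)) :=
    memLp_of_continuous (continuous_cosineSeries (hc.summable_abs hab.ne (by linarith [hs.1])))
  have hvirial := half_tsum_le_neg_integral_sawtooth_mul hab hs hc hu hx₀ hu₀
  set h := fracLaplacianDeriv a b s c
  have hbound : -∫ x in Ioo a b, sawtooth a b x₀ x * cosineSeries a b c x * h x ≤
      (b - a) * ∫ x in Ioo a b, |cosineSeries a b c x * h x| := by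
    rw [← integral_neg, ← integral_const_mul]
    refine integral_mono_ae ((memLp_sawtooth_mul x₀ hmem).integrable_mul (Lp.memLp h)).neg
      ((hmem.integrable_mul (Lp.memLp h)).abs.const_mul _) ?_
    filter_upwards [ae_restrict_mem measurableSet_Ioo] with x hx
    refine (neg_le_abs _).trans ?_
    rw [mul_assoc, abs_mul]
    exact mul_le_mul_of_nonneg_right (abs_sawtooth_le (Ioo_subset_Icc_self hx)) (abs_nonneg _)
  rw [one_div, inv_mul_le_iff₀ (by positivity)]
  linarith

/-! ### Nonnegative functions -/

theorem ae_eq_cosineSeries (hab : a < b) (hv : MemLp v 2 (volume.restrict (Ioo a b)))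
    (hc : Summable fun k => |neumannCoeff a b v k|) :
    v =ᵐ[volume.restrict (Ioo a b)] cosineSeries a b (neumannCoeff a b v) := by
  have hu : MemLp (cosineSeries a b (neumannCoeff a b v)) 2 (volume.restrict (Ioo a b)) :=
    memLp_of_continuous (continuous_cosineSeries hc)
  have hzero := ae_eq_zero_of_neumannCoeff_eq_zero hab
    ((hv.sub hu).integrable one_le_two) fun k => by
      have hφ := memLp_neumannEigenfunction a b k
      have hcoeff := integral_cosineSeries_mul_neumannEigenfunction hab hc k
      rw [← integral_Ioo_eq_intervalIntegral hab.le] at hcoeff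
      simp only [neumannCoeff, Pi.sub_apply, sub_mul]
      exact (integral_sub (hv.integrable_mul hφ) (hu.integrable_mul hφ)).trans
        (sub_eq_zero.2 hcoeff.symm)
  filter_upwards [hzero] with x hx
  exact sub_eq_zero.1 hx

theorem nonneg_on_Icc_of_ae_restrict_Ioo {f : ℝ → ℝ} (hab : a ≠ b) (hf : ContinuousOn f (Icc a b))
    (h : ∀ᵐ x ∂volume.restrict (Ioo a b), 0 ≤ f x) : ∀ x ∈ Icc a b, 0 ≤ f x := by
  rw [Measure.restrict_congr_set Ioo_ae_eq_Icc] at h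
  have habs : EqOn |f| f (Icc a b) := Measure.eqOn_Icc_of_ae_eq volume hab
    (h.mono fun x hx => abs_of_nonneg hx) hf.abs hf
  exact fun x hx => abs_eq_self.1 (habs hx)

theorem cosineSeries_update_zero (hab : a < b) (hc : Summable fun k => |c k|) (m x : ℝ) :
    cosineSeries a b (Function.update c 0 (c 0 - m * Real.sqrt (b - a))) x =
      cosineSeries a b c x - m := by
  have hL : Real.sqrt (b - a) ≠ 0 := (Real.sqrt_pos.2 (sub_pos.2 hab)).ne'
  have hsum := (summable_mul_neumannEigenfunction (a := a) (b := b) hc x).hasSum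
  refine ((hsum.sub (hasSum_ite_eq 0 m)).congr_fun fun k => ?_).tsum_eq
  rcases eq_or_ne k 0 with rfl | hk
  · simp [neumannEigenfunction]
    field_simp
  · simp [hk]

theorem tsum_le_integral_abs_mul_fracLaplacianDeriv (hab : a < b) (hs : s ∈ Ioo (0 : ℝ) 1)
    (hv : MemHN a b (2 * s + 1) v) (hv₀ : ∀ᵐ x ∂volume.restrict (Ioo a b), 0 ≤ v x) :
    1 / (2 * (b - a)) * ∑' k, neumannEigenvalue a b k ^ s * neumannCoeff a b v k ^ 2 ≤
      ∫ x in Ioo a b, |v x * fracLaplacianDeriv a b s (neumannCoeff a b v) x| := by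
  obtain ⟨hvL, hc⟩ := hv
  change IsSobolevSeq a b (2 * s + 1) _ at hc
  set c := neumannCoeff a b v
  have hcabs := hc.summable_abs hab.ne (by linarith [hs.1])
  have hu : ContinuousOn (cosineSeries a b c) (Icc a b) :=
    (continuous_cosineSeries hcabs).continuousOn
  have hvu := ae_eq_cosineSeries hab hvL hcabs
  obtain ⟨x₀, hx₀, hmin⟩ := isCompact_Icc.exists_isMinOn (nonempty_Icc.2 hab.le) hu
  set m := cosineSeries a b c x₀
  have hm : 0 ≤ m := nonneg_on_Icc_of_ae_restrict_Ioo hab.ne hu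
    (by filter_upwards [hv₀, hvu] with x hx hxu using hxu ▸ hx) x₀ hx₀
  -- Subtracting the minimum only changes the coefficient of the constant mode, which `-Δ` kills.
  have hshift := cosineSeries_update_zero hab hcabs m
  set c' := Function.update c 0 (c 0 - m * Real.sqrt (b - a))
  have hbound := tsum_le_integral_abs_cosineSeries_mul (c := c') hab hs (hc.update_zero _)
    (fun x hx => (hshift x).symm ▸ sub_nonneg.2 (hmin hx)) hx₀ ((hshift x₀).trans (sub_self m))
  have henergy (k : ℕ) : neumannEigenvalue a b k ^ s * c' k ^ 2 =
      neumannEigenvalue a b k ^ s * c k ^ 2 := by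
    rcases k with _ | k
    · rw [neumannEigenvalue_zero, Real.zero_rpow hs.1.ne', zero_mul, zero_mul]
    · rw [show c' (k + 1) = c (k + 1) from Function.update_of_ne k.succ_ne_zero _ _]
  simp_rw [henergy, hshift, c', fracLaplacianDeriv_update_zero] at hbound
  refine hbound.trans (integral_mono_of_nonneg (.of_forall fun x => abs_nonneg _)
    (hvL.integrable_mul (Lp.memLp _)).abs ?_)
  filter_upwards [hvu, ae_restrict_mem measurableSet_Ioo] with x hx hxI
  have hum : m ≤ cosineSeries a b c x := hmin (Ioo_subset_Icc_self hxI)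
  rw [hx, abs_mul, abs_mul, abs_of_nonneg (sub_nonneg.2 hum), abs_of_nonneg (hm.trans hum)]
  exact mul_le_mul_of_nonneg_right (sub_le_self _ hm) (abs_nonneg _)

theorem ofReal_integral_sq_le_lintegral_abs_mul (hab : a < b) (hs : s ∈ Ioo (0 : ℝ) 1)
    (hv : MemHN a b (2 * s + 1) v) (hv₀ : ∀ᵐ x ∂volume.restrict (Ioo a b), 0 ≤ v x) {h : ℝ → ℝ}
    (hh : HasWeakDerivOn a b (neumannFracLaplacian a b s v) h) :
    ENNReal.ofReal (1 / (2 * (b - a)) *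
        ∫ x in Ioo a b, |neumannFracLaplacian a b (s / 2) v x| ^ 2) ≤
      ∫⁻ x in Ioo a b, ENNReal.ofReal |v x * h x| := by
  set h₀ := fracLaplacianDeriv a b s (neumannCoeff a b v)
  have hae : h =ᵐ[volume.restrict (Ioo a b)] h₀ :=
    hh.ae_eq (hasWeakDerivOn_neumannFracLaplacian hab hs.1.le hv)
  have henergy := integral_sq_neumannFracLaplacian_half hab hs.1.le
    ⟨hv.1, IsSobolevSeq.mono hv.2 hs.1.le (by linarith [hs.1])⟩
  have hint : Integrable (fun x => |v x * h₀ x|) (volume.restrict (Ioo a b)) :=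
    (hv.1.integrable_mul (Lp.memLp h₀)).abs
  have habs : ∫⁻ x in Ioo a b, ENNReal.ofReal |v x * h x| =
      ENNReal.ofReal (∫ x in Ioo a b, |v x * h₀ x|) := by
    rw [ofReal_integral_eq_lintegral_ofReal hint (.of_forall fun x => abs_nonneg _)]
    exact lintegral_congr_ae (hae.mono fun x hx => by simp only [hx])
  simp_rw [sq_abs]
  rw [habs, henergy]
  exact ENNReal.ofReal_le_ofReal (tsum_le_integral_abs_mul_fracLaplacianDeriv hab hs hv hv₀)

end FracLaplacian

/-! ### The weighted Cauchy–Schwarz inequality -/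

section Weighted

variable {α : Type*} [MeasurableSpace α] {μ : Measure α}

theorem sq_lintegral_rpow_half_mul_le {f g : α → ℝ≥0∞} (hf : AEMeasurable f μ)
    (hg : AEMeasurable g μ) :
    (∫⁻ x, (f x * g x) ^ (1 / 2 : ℝ) ∂μ) ^ 2 ≤ (∫⁻ x, f x ∂μ) * ∫⁻ x, g x ∂μ := by
  have hsq (y : ℝ≥0∞) : (y ^ (1 / 2 : ℝ)) ^ (2 : ℝ) = y := by
    rw [← ENNReal.rpow_mul, one_div_mul_cancel two_ne_zero, ENNReal.rpow_one]
  have hholder := ENNReal.lintegral_mul_le_Lp_mul_Lq μ Real.HolderConjugate.two_two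
    (hf.pow_const (1 / 2 : ℝ)) (hg.pow_const (1 / 2 : ℝ))
  simp only [Pi.mul_apply, hsq, ← ENNReal.mul_rpow_of_nonneg _ _ one_half_pos.le] at hholder
  rw [← hsq ((∫⁻ x, f x ∂μ) * _), ENNReal.rpow_two]
  exact pow_le_pow_left' hholder 2

theorem ofReal_abs_mul_le_rpow_half {y z : ℝ} {w : ℝ≥0}
    (h : ENNReal.ofReal (y ^ 2) / (w : ℝ≥0∞) ≠ ⊤) :
    ENNReal.ofReal |y * z| ≤
      (ENNReal.ofReal (y ^ 2) / (w : ℝ≥0∞) * (w * ENNReal.ofReal (z ^ 2))) ^ (1 / 2 : ℝ) := by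
  rcases eq_or_ne w 0 with rfl | hw
  · have hy : y = 0 := by
      by_contra hne
      exact h (by simp [ENNReal.div_zero, hne])
    simp [hy]
  · rw [← mul_assoc, ENNReal.div_mul_cancel (ENNReal.coe_ne_zero.2 hw) ENNReal.coe_ne_top,
      ← ENNReal.ofReal_mul (sq_nonneg _), ENNReal.ofReal_rpow_of_nonneg (by positivity)
      one_half_pos.le, ← mul_pow, ← Real.sqrt_eq_rpow, Real.sqrt_sq_eq_abs]

theorem sq_lintegral_abs_mul_le_weighted {f g : α → ℝ} {w : α → ℝ≥0} (hf : AEMeasurable f μ)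
    (hg : AEMeasurable g μ) (hw : AEMeasurable w μ)
    (h : (∫⁻ x, ENNReal.ofReal (f x ^ 2) / (w x : ℝ≥0∞) ∂μ) ≠ ⊤ ∨
      (∫⁻ x, (w x : ℝ≥0∞) * ENNReal.ofReal (g x ^ 2) ∂μ) ≠ 0) :
    (∫⁻ x, ENNReal.ofReal |f x * g x| ∂μ) ^ 2 ≤
      (∫⁻ x, ENNReal.ofReal (f x ^ 2) / (w x : ℝ≥0∞) ∂μ) *
        ∫⁻ x, (w x : ℝ≥0∞) * ENNReal.ofReal (g x ^ 2) ∂μ := by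
  have hF : AEMeasurable (fun x => ENNReal.ofReal (f x ^ 2) / (w x : ℝ≥0∞)) μ :=
    (hf.pow_const 2).ennreal_ofReal.div hw.coe_nnreal_ennreal
  have hG : AEMeasurable (fun x => (w x : ℝ≥0∞) * ENNReal.ofReal (g x ^ 2)) μ :=
    hw.coe_nnreal_ennreal.mul (hg.pow_const 2).ennreal_ofReal
  by_cases hA : ∫⁻ x, ENNReal.ofReal (f x ^ 2) / (w x : ℝ≥0∞) ∂μ = ⊤
  · rw [hA, ENNReal.top_mul (h.resolve_left (not_not.2 hA))]
    exact le_top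
  · refine (pow_le_pow_left' (lintegral_mono_ae ?_) 2).trans (sq_lintegral_rpow_half_mul_le hF hG)
    filter_upwards [ae_lt_top' hF hA] with x hx
    exact ofReal_abs_mul_le_rpow_half hx.ne

end Weighted

theorem lemma3p4 (a b s : ℝ) (hab : a < b) (hs0 : 0 < s) (hs1 : s < 1)
    (v : ℝ → ℝ) (hv : MemHN a b (2 * s + 1) v)
    (hv0 : ∀ᵐ x ∂(volume.restrict (Ioo a b)), 0 ≤ v x) :
    (∃ h : ℝ → ℝ, MemLp h 2 (volume.restrict (Ioo a b)) ∧
      HasWeakDerivOn a b (neumannFracLaplacian a b s v) h) ∧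
    ∀ h : ℝ → ℝ, HasWeakDerivOn a b (neumannFracLaplacian a b s v) h →
      ∀ w : ℝ → ℝ≥0, AEMeasurable w (volume.restrict (Ioo a b)) →
        -- the product on the right below is not of the indeterminate form `∞ · 0`
        ((∫⁻ x in Ioo a b, ENNReal.ofReal (v x ^ 2) / (w x : ℝ≥0∞)) ≠ ⊤ ∨
          (∫⁻ x in Ioo a b, (w x : ℝ≥0∞) * ENNReal.ofReal (h x ^ 2)) ≠ 0) →
        ENNReal.ofReal (1 / (4 * (b - a) ^ 2) *
            (∫ x in Ioo a b, |neumannFracLaplacian a b (s / 2) v x| ^ 2) ^ 2) ≤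
          (∫⁻ x in Ioo a b, ENNReal.ofReal (v x ^ 2) / (w x : ℝ≥0∞)) *
            ∫⁻ x in Ioo a b, (w x : ℝ≥0∞) * ENNReal.ofReal (h x ^ 2) := by
  refine ⟨⟨_, Lp.memLp _, hasWeakDerivOn_neumannFracLaplacian hab hs0.le hv⟩,
    fun h hh w hw hind => ?_⟩
  calc ENNReal.ofReal (1 / (4 * (b - a) ^ 2) *
        (∫ x in Ioo a b, |neumannFracLaplacian a b (s / 2) v x| ^ 2) ^ 2)
    _ = ENNReal.ofReal (1 / (2 * (b - a)) *
          ∫ x in Ioo a b, |neumannFracLaplacian a b (s / 2) v x| ^ 2) ^ 2 := by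
      have hL := sub_pos.2 hab
      rw [← ENNReal.ofReal_pow (by positivity)]
      congr 1
      field_simp
      norm_num
    _ ≤ (∫⁻ x in Ioo a b, ENNReal.ofReal |v x * h x|) ^ 2 :=
      pow_le_pow_left' (ofReal_integral_sq_le_lintegral_abs_mul hab ⟨hs0, hs1⟩ hv hv0 hh) 2
    _ ≤ _ := sq_lintegral_abs_mul_le_weighted hv.1.1.aemeasurable
      hh.2.1.aestronglyMeasurable.aemeasurable hw hind
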